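/- Conventions: $S^1=\mathbb R/\mathbb Z$; manifolds are smooth, finite-dimensional, Hausdorff, second countable, without boundary. A symplectic manifold $(M,\omega)$ is \emph{integral} if the de Rham class $[\omega]\in H^2(M;\mathbb R)$ lies in the image of $H^2(M;\mathbb Z)\to H^2(M;\mathbb R)$. An \emph{anti-symplectic involution} of $(M,\omega)$ is a diffeomorphism $R$ of $M$ with $R^2=\mathrm{id}$ and $R^*\omega=-\omega$. Let $p:E\to M$ be a smooth complex line bundle. A \emph{connection 1-form} on $E$ is a smooth real 1-form $\alpha$ on $E\setminus M$ (the complement of the zero section) that is invariant under fibrewise multiplication by $\mathbb C\setminus\{0\}$, equals $1$ on the generator of the circle action $(t,u)\mapsto e^{2\pi i t}u$, and vanishes on the radial direction. Its curvature is the 2-form $F_\alpha$ on $M$ with $d\alpha=p^*F_\alpha$, and its holonomy around a smooth loop $\gamma:S^1\to M$ is $\mathrm{hol}_\alpha(\gamma)=-\int_{S^1}\eta^*\alpha\in\mathbb R/\mathbb Z$ for any smooth loop $\eta:S^1\to E\setminus M$ with $p\circ\eta=\gamma$. Let $L\subset M$ be a (possibly empty) embedded Lagrangian submanifold. The pair $(E,\alpha)$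 is a \emph{Bohr--Sommerfeld pair} for $(M,\omega,L)$ if (1) $F_\alpha=N\omega$ for some integer $N>0$, and (2) the holonomy homomorphism $\mathrm{hol}_{\alpha|_L}:\pi_1(L,x)\to\mathbb R/\mathbb Z$ (which sends the class of a smooth loop in $L$ to the holonomy around it) takes values in $\{0,\tfrac12\}$, for every base point $x\in L$. \textbf{Theorem.} Let $(M,\omega)$ be an integral symplectic manifold and let $R$ be an anti-symplectic involution of $(M,\omega)$. Then the fixed point set $\mathrm{Fix}\,R$ is a (possibly empty) embedded Lagrangian submanifold, and there exists a Bohr--Sommerfeld pair for $(M,\omega,\mathrm{Fix}\,R)$. -/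

import Mathlib

open scoped Manifold ContDiff Topology
open Bundle

noncomputable section

namespace BohrSommerfeld

/-! ### Differential forms on (boundaryless) manifolds -/

section Forms

variable {E : Type*} [NormedAddCommGroup E] [NormedSpace ℝ E]
  {H : Type*} [TopologicalSpace H] (I : ModelWithCorners ℝ E H)
  (M : Type*) [TopologicalSpace M] [ChartedSpace H M]

/-- A (not necessarily continuous) real differential `n`-form on `M`. -/
abbrev DiffForm (n : ℕ) : Type _ := Π x : M, TangentSpace I x [⋀^Fin n]→L[ℝ] ℝ

variable {I M} {n : ℕ}

/-- The pullback `f^* Ω` of a form. -/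
def DiffForm.pullback {E' : Type*} [NormedAddCommGroup E'] [NormedSpace ℝ E']
    {H' : Type*} [TopologicalSpace H'] {I' : ModelWithCorners ℝ E' H'}
    {M' : Type*} [TopologicalSpace M'] [ChartedSpace H' M']
    (f : M' → M) (Ω : DiffForm I M n) : DiffForm I' M' n :=
  fun x => (Ω (f x)).compContinuousLinearMap (mfderiv I' I f x)

/-- The form `Ω` written in the preferred chart around `x₀`. -/
def DiffForm.inChart (Ω : DiffForm I M n) (x₀ : M) : E → E [⋀^Fin n]→L[ℝ] ℝ :=
  DiffForm.pullback (I' := 𝓘(ℝ, E)) (extChartAt I x₀).symm Ω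

/-- Smoothness of a form on an open set `U`: it is smooth in all preferred charts. -/
def DiffForm.SmoothOn (Ω : DiffForm I M n) (U : Set M) : Prop :=
  ∀ x₀ : M, ContDiffOn ℝ ∞ (DiffForm.inChart Ω x₀)
    ((extChartAt I x₀).target ∩ (extChartAt I x₀).symm ⁻¹' U)

/-- The exterior derivative: at `x`, it is computed in the preferred chart around `x`. -/
def DiffForm.d (Ω : DiffForm I M n) : DiffForm I M (n + 1) :=
  fun x => (extDeriv (DiffForm.inChart Ω x) (extChartAt I x x)).compContinuousLinearMap
    (mfderiv I 𝓘(ℝ, E) (extChartAt I x) x)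

end Forms

/-! ### Smooth singular cochains and integrality -/

section Singular

variable {E : Type*} [NormedAddCommGroup E] [NormedSpace ℝ E]
  {H : Type*} [TopologicalSpace H] (I : ModelWithCorners ℝ E H)
  (M : Type*) [TopologicalSpace M] [ChartedSpace H M]

/-- A smooth singular `n`-simplex: a map on the standard simplex (in barycentric coordinates)
that extends to a smooth map on an open neighbourhood of it. -/
structure SmoothSimplex (n : ℕ) where
  toFun : stdSimplex ℝ (Fin (n + 1)) → M
  smooth : ∃ (U : Set (Fin (n + 1) → ℝ)) (f : (Fin (n + 1) → ℝ) → M),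
    IsOpen U ∧ stdSimplex ℝ (Fin (n + 1)) ⊆ U ∧
      ContMDiffOn 𝓘(ℝ, Fin (n + 1) → ℝ) I ∞ f U ∧ ∀ x, toFun x = f x

/-- The `i`-th face inclusion `(t₀, …, tₙ) ↦ (t₀, …, 0, …, tₙ)` of the standard simplex. -/
lemma insertNth_mem_stdSimplex {n : ℕ} (i : Fin (n + 2)) {t : Fin (n + 1) → ℝ}
    (ht : t ∈ stdSimplex ℝ (Fin (n + 1))) :
    (i.insertNth (0 : ℝ) t : Fin (n + 2) → ℝ) ∈ stdSimplex ℝ (Fin (n + 2)) := by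
  refine ⟨fun j => ?_, ?_⟩
  · refine Fin.succAboveCases i ?_ (fun k => ?_) j
    · simp
    · simpa using ht.1 k
  · rw [Fin.sum_univ_succAbove _ i]
    simpa using ht.2

lemma contDiff_insertNth {n : ℕ} (i : Fin (n + 2)) :
    ContDiff ℝ ∞ (fun t : Fin (n + 1) → ℝ => (i.insertNth (0 : ℝ) t : Fin (n + 2) → ℝ)) := by
  rw [contDiff_pi]
  intro j
  refine Fin.succAboveCases i ?_ (fun k => ?_) j
  · simpa using contDiff_const
  · simpa using contDiff_apply ℝ ℝ k

variable {I M}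

/-- The `i`-th face of a smooth singular simplex. -/
def SmoothSimplex.face {n : ℕ} (σ : SmoothSimplex I M (n + 1)) (i : Fin (n + 2)) :
    SmoothSimplex I M n where
  toFun t := σ.toFun ⟨i.insertNth (0 : ℝ) t.1, insertNth_mem_stdSimplex i t.2⟩
  smooth := by
    obtain ⟨U, f, hU, hsub, hf, heq⟩ := σ.smooth
    refine ⟨(fun t : Fin (n + 1) → ℝ => (i.insertNth (0 : ℝ) t : Fin (n + 2) → ℝ)) ⁻¹' U,
      fun t => f (i.insertNth (0 : ℝ) t), hU.preimage (contDiff_insertNth i).continuous,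
      fun t ht => hsub (insertNth_mem_stdSimplex i ht), ?_, fun t => heq _⟩
    exact hf.comp (contDiff_insertNth i).contMDiff.contMDiffOn (fun t ht => ht)

/-- The smooth singular coboundary `(δc)(σ) = ∑ᵢ (-1)ⁱ c(∂ᵢ σ)`. Cochains with values in `A` on the
free abelian group of smooth singular `n`-simplices are functions on simplices. -/
def coboundary {A : Type*} [AddCommGroup A] {n : ℕ} (c : SmoothSimplex I M n → A) :
    SmoothSimplex I M (n + 1) → A :=
  fun σ => ∑ i : Fin (n + 2), (-1 : ℤ) ^ (i : ℕ) • c (σ.face i)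

open Classical in
/-- The simplex in the affine coordinates `(t₁, …, tₙ)`, with `t₀ = 1 - ∑ tᵢ`
(and an irrelevant constant value off the coordinate simplex). -/
def SmoothSimplex.param {n : ℕ} (σ : SmoothSimplex I M n) (t : Fin n → ℝ) : M :=
  if h : (Fin.cons (1 - ∑ i, t i) t : Fin (n + 1) → ℝ) ∈ stdSimplex ℝ (Fin (n + 1)) then
    σ.toFun ⟨_, h⟩
  else σ.toFun ⟨Pi.single 0 1, single_mem_stdSimplex ℝ 0⟩

/-- The integral `∫_σ Ω` of an `n`-form over a smooth singular `n`-simplex (the integral runs over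
the interior of the coordinate simplex; the boundary is a null set). -/
def SmoothSimplex.integral {n : ℕ} (σ : SmoothSimplex I M n) (Ω : DiffForm I M n) : ℝ :=
  ∫ t in {t : Fin n → ℝ | (∀ i, 0 < t i) ∧ ∑ i, t i < 1},
    DiffForm.pullback (I' := 𝓘(ℝ, Fin n → ℝ)) σ.param Ω t (fun i => (Pi.single i 1 : Fin n → ℝ))

/-- Integrality of a closed 2-form, `[Ω] ∈ H²(M; ℤ)`: there is a class `[c] ∈ H²(M; ℤ)`, given by an
integral smooth singular cocycle `c`, whose image in `H²(M; ℝ)` is the de Rham class of `Ω`, i.e.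
the cocycles `σ ↦ ∫_σ Ω` and `c` differ by a real coboundary. -/
def IsIntegral (Ω : DiffForm I M 2) : Prop :=
  ∃ c : SmoothSimplex I M 2 → ℤ, coboundary c = 0 ∧
    ∃ b : SmoothSimplex I M 1 → ℝ, ∀ σ : SmoothSimplex I M 2,
      σ.integral Ω = c σ + coboundary b σ

end Singular

/-! ### Symplectic manifolds, anti-symplectic involutions, Lagrangian submanifolds -/

section Symplectic

variable {E : Type*} [NormedAddCommGroup E] [NormedSpace ℝ E]
  {M : Type*} [TopologicalSpace M] [ChartedSpace E M]

/-- `Ω` is a symplectic form: smooth, closed and nondegenerate. -/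
structure IsSymplectic (Ω : DiffForm 𝓘(ℝ, E) M 2) : Prop where
  smooth : DiffForm.SmoothOn Ω Set.univ
  closed : DiffForm.d Ω = 0
  nondegenerate : ∀ (x : M) (v : TangentSpace 𝓘(ℝ, E) x), (∀ w, Ω x ![v, w] = 0) → v = 0

/-- `R` is an anti-symplectic involution: smooth, `R² = id` (hence a diffeomorphism),
`R^* Ω = -Ω`. -/
structure IsAntisymplecticInvolution (Ω : DiffForm 𝓘(ℝ, E) M 2) (R : M → M) : Prop where
  smooth : ContMDiff 𝓘(ℝ, E) 𝓘(ℝ, E) ∞ R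
  involutive : Function.Involutive R
  anti : DiffForm.pullback R Ω = -Ω

/-- `L` is a (possibly empty) embedded Lagrangian submanifold: around each of its points there is a
smooth chart `φ` of `M` in which `L` is a linear subspace `W`, and each tangent space
`T_y L = (dφ_y)⁻¹(W)` equals its own `Ω`-orthogonal complement. -/
def IsLagrangianSubmanifold (Ω : DiffForm 𝓘(ℝ, E) M 2) (L : Set M) : Prop :=
  ∀ x ∈ L, ∃ φ ∈ IsManifold.maximalAtlas 𝓘(ℝ, E) ∞ M, x ∈ φ.source ∧
    ∃ W : Submodule ℝ E, (∀ y ∈ φ.source, y ∈ L ↔ φ y ∈ W) ∧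
      ∀ y ∈ φ.source, y ∈ L → ∀ v : TangentSpace 𝓘(ℝ, E) y,
        (mfderiv 𝓘(ℝ, E) 𝓘(ℝ, E) φ y v : E) ∈ W ↔
          ∀ w : TangentSpace 𝓘(ℝ, E) y,
            (mfderiv 𝓘(ℝ, E) 𝓘(ℝ, E) φ y w : E) ∈ W → Ω y ![v, w] = 0

end Symplectic

/-! ### Complex line bundles with connection -/

section LineBundle

variable (E : Type*) [NormedAddCommGroup E] [NormedSpace ℝ E]
  (M : Type*) [TopologicalSpace M] [ChartedSpace E M]

/-- A smooth complex line bundle over the (real) manifold `M`: a complex vector bundle with typical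
fibre `ℂ` whose transition functions are smooth in the real sense. -/
structure ComplexLineBundle where
  Fiber : M → Type
  [addCommGroup : ∀ x, AddCommGroup (Fiber x)]
  [module : ∀ x, Module ℂ (Fiber x)]
  [topFiber : ∀ x, TopologicalSpace (Fiber x)]
  [topTotal : TopologicalSpace (TotalSpace ℂ Fiber)]
  [fiberBundle : FiberBundle ℂ Fiber]
  [vectorBundleComplex : VectorBundle ℂ ℂ Fiber]
  [vectorBundleReal : VectorBundle ℝ ℂ Fiber]
  [smooth : ContMDiffVectorBundle ∞ ℂ Fiber 𝓘(ℝ, E)]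

attribute [instance] ComplexLineBundle.addCommGroup ComplexLineBundle.module
  ComplexLineBundle.topFiber ComplexLineBundle.topTotal ComplexLineBundle.fiberBundle
  ComplexLineBundle.vectorBundleComplex ComplexLineBundle.vectorBundleReal
  ComplexLineBundle.smooth

variable {E M}

/-- The total space of a complex line bundle. -/
abbrev ComplexLineBundle.Total (B : ComplexLineBundle E M) : Type _ := TotalSpace ℂ B.Fiber

/-- The model of the total space, as a real manifold. -/
abbrev totalModel (E : Type*) [NormedAddCommGroup E] [NormedSpace ℝ E] :
    ModelWithCorners ℝ (E × ℂ) (ModelProd E ℂ) := 𝓘(ℝ, E).prod 𝓘(ℝ, ℂ)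

/-- Fibrewise multiplication by a complex number. -/
def ComplexLineBundle.mul (B : ComplexLineBundle E M) (z : ℂ) (u : B.Total) : B.Total :=
  ⟨u.proj, z • u.2⟩

/-- The complement of the zero section. -/
def ComplexLineBundle.nonzero (B : ComplexLineBundle E M) : Set B.Total := {u | u.2 ≠ 0}

/-- The vertical vector `d/ds|₀ exp(s ζ) u` at `u`, for `ζ ∈ ℂ`. -/
def ComplexLineBundle.vertical (B : ComplexLineBundle E M) (ζ : ℂ) (u : B.Total) :
    TangentSpace (totalModel E) (B.mul (Complex.exp ((0 : ℝ) * ζ)) u) :=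
  mfderiv 𝓘(ℝ, ℝ) (totalModel E) (fun s : ℝ => B.mul (Complex.exp (s * ζ)) u) 0 (1 : ℝ)

/-- A connection 1-form: a real 1-form on the complement of the zero section (its values on the zero
section are irrelevant) that is smooth, invariant under multiplication by nonzero complex numbers,
equals `1` on the generator of the circle action `t ↦ e^{2πit} u` of `S¹ = ℝ/ℤ`, and vanishes on the
radial direction. -/
structure ConnectionForm (B : ComplexLineBundle E M) where
  form : DiffForm (totalModel E) B.Total 1
  smooth : DiffForm.SmoothOn form B.nonzero
  invariant : ∀ z : ℂ, z ≠ 0 → ∀ u ∈ B.nonzero, DiffForm.pullback (B.mul z) form u = form u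
  generator : ∀ u ∈ B.nonzero, form _ ![B.vertical (2 * Real.pi * Complex.I) u] = 1
  radial : ∀ u ∈ B.nonzero, form _ ![B.vertical 1 u] = 0

/-- The curvature of `α` is the 2-form `F` on `M`: `dα = p^* F` off the zero section. -/
def ConnectionForm.HasCurvature {B : ComplexLineBundle E M} (α : ConnectionForm B)
    (F : DiffForm 𝓘(ℝ, E) M 2) : Prop :=
  ∀ u ∈ B.nonzero, DiffForm.d α.form u = DiffForm.pullback (TotalSpace.proj : B.Total → M) F u

/-- `h ∈ ℝ/ℤ` is the holonomy of `α` around the smooth loop `γ : ℝ/ℤ → M`, written as a 1-periodic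
map on `ℝ`: `h = -∫₀¹ η^* α` for a smooth loop `η` off the zero section lying over `γ`. -/
def ConnectionForm.HasHolonomy {B : ComplexLineBundle E M} (α : ConnectionForm B) (γ : ℝ → M)
    (h : UnitAddCircle) : Prop :=
  ∃ η : ℝ → B.Total, ContMDiff 𝓘(ℝ, ℝ) (totalModel E) ∞ η ∧ Function.Periodic η 1 ∧
    (∀ t, η t ∈ B.nonzero) ∧ (∀ t, (η t).proj = γ t) ∧
      h = ((-∫ t in (0 : ℝ)..1,
        α.form (η t) ![mfderiv 𝓘(ℝ, ℝ) (totalModel E) η t (1 : ℝ)] : ℝ) : UnitAddCircle)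

/-- `(B, α)` is a Bohr–Sommerfeld pair for the Lagrangian submanifold `L` of `(M, Ω)`:
the curvature of `α` is a positive integer multiple of `Ω`, and the holonomy homomorphism
`π₁(L, x) → ℝ/ℤ` of `α` over `L` (the homomorphism sending the class of each smooth loop in `L` to
the holonomy around it) takes values in `{0, 1/2}`, for every base point `x ∈ L`. -/
structure IsBohrSommerfeldPair (Ω : DiffForm 𝓘(ℝ, E) M 2) (L : Set M)
    (B : ComplexLineBundle E M) (α : ConnectionForm B) : Prop where
  lagrangian : IsLagrangianSubmanifold Ω L
  curvature : ∃ N : ℕ, 0 < N ∧ α.HasCurvature ((N : ℝ) • Ω)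
  holonomy : ∀ x : L, ∃ hol : FundamentalGroup L x →* Multiplicative UnitAddCircle,
    (∀ (p : Path x x) (γ : ℝ → M), ContMDiff 𝓘(ℝ, ℝ) 𝓘(ℝ, E) ∞ γ → Function.Periodic γ 1 →
      (∀ t : unitInterval, γ t = p t) →
        α.HasHolonomy γ (hol (FundamentalGroup.fromPath ⟦p⟧)).toAdd) ∧
    ∀ g, (hol g).toAdd = 0 ∨ (hol g).toAdd = ((1 / 2 : ℝ) : UnitAddCircle)

end LineBundle

end BohrSommerfeld

end

noncomputable section

namespace BohrSommerfeld

section ParametricIntegral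

universe u

variable {E : Type u} [NormedAddCommGroup E] [NormedSpace ℝ E] [FiniteDimensional ℝ E]

open Set Filter MeasureTheory in
/-- Differentiation under the integral sign over `[0, 1]` for a `C^1` integrand. -/
lemma hasFDerivAt_integral_unitInterval {G : Type*} [NormedAddCommGroup G] [NormedSpace ℝ G]
    {W : Set (E × ℝ)} (hW : IsOpen W) {F : E × ℝ → G}
    (hF : ContDiffOn ℝ 1 F W) {x : E} (hx : ∀ t ∈ Icc (0 : ℝ) 1, (x, t) ∈ W) :
    HasFDerivAt (fun y => ∫ t in (0 : ℝ)..1, F (y, t))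
      (∫ t in (0 : ℝ)..1, (fderiv ℝ F (x, t)).comp (ContinuousLinearMap.inl ℝ E ℝ)) x := by
  have hF' : ContinuousOn (fun p => (fderiv ℝ F p).comp (ContinuousLinearMap.inl ℝ E ℝ)) W :=
    (hF.continuousOn_fderiv_of_isOpen hW le_rfl).clm_comp continuousOn_const
  obtain ⟨u, v, huo, -, hxu, htv, huv⟩ := generalized_tube_lemma (isCompact_singleton (x := x))
    (isCompact_Icc (a := (0 : ℝ)) (b := 1)) hW (by
      rintro ⟨y, t⟩ ⟨hy, ht⟩

      obtain rfl : y = x := hy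
      exact hx t ht)
  obtain ⟨ε, hε, hεu⟩ := Metric.nhds_basis_closedBall.mem_iff.1
    (huo.mem_nhds (hxu (mem_singleton x)))
  have hsub : Metric.closedBall x ε ×ˢ Icc (0 : ℝ) 1 ⊆ W :=
    (prod_mono hεu htv).trans huv
  have hK : IsCompact (Metric.closedBall x ε ×ˢ Icc (0 : ℝ) 1) :=
    (isCompact_closedBall x ε).prod isCompact_Icc
  obtain ⟨C, hC⟩ := hK.exists_bound_of_continuousOn (hF'.mono hsub)
  have hsec : ∀ y ∈ Metric.closedBall x ε, MapsTo (fun t : ℝ => (y, t)) (Icc (0 : ℝ) 1) W :=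
    fun y hy t ht => hsub ⟨hy, ht⟩
  have hc : ∀ y ∈ Metric.closedBall x ε, ContinuousOn (fun t : ℝ => F (y, t)) (Icc 0 1) :=
    fun y hy => hF.continuousOn.comp (by fun_prop) (hsec y hy)
  have hI : uIoc (0 : ℝ) 1 ⊆ Icc (0 : ℝ) 1 := by
    rw [uIoc_of_le zero_le_one]; exact Ioc_subset_Icc_self
  have hxε : x ∈ Metric.closedBall x ε := Metric.mem_closedBall_self hε.le
  refine intervalIntegral.hasFDerivAt_integral_of_dominated_of_fderiv_le
    (F := fun y t => F (y, t))
    (F' := fun y t => (fderiv ℝ F (y, t)).comp (ContinuousLinearMap.inl ℝ E ℝ))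
    (bound := fun _ => C) (Metric.closedBall_mem_nhds x hε) ?_ ?_ ?_ ?_ ?_ ?_
  · filter_upwards [Metric.closedBall_mem_nhds x hε] with y hy
    exact ((hc y hy).mono hI).aestronglyMeasurable measurableSet_uIoc
  · exact (by simpa [uIcc_of_le] using hc x hxε : ContinuousOn _ (uIcc (0 : ℝ) 1)).intervalIntegrable
  · exact ((hF'.comp (by fun_prop) (hsec x hxε)).mono hI).aestronglyMeasurable measurableSet_uIoc
  · exact ae_of_all _ fun t ht y hy => hC (y, t) ⟨hy, hI ht⟩
  · exact intervalIntegrable_const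
  · refine ae_of_all _ fun t ht y hy => ?_
    have h1 : HasFDerivAt F (fderiv ℝ F (y, t)) (y, t) :=
      ((hF.contDiffAt (hW.mem_nhds (hsub ⟨hy, hI ht⟩))).differentiableAt one_ne_zero).hasFDerivAt
    have h2 : HasFDerivAt (fun y : E => (y, t)) (ContinuousLinearMap.inl ℝ E ℝ) y :=
      hasFDerivAt_prodMk_left y t
    exact HasFDerivAt.comp y h1 h2

open Set in
lemma contDiffOn_nat_integral_unitInterval (n : ℕ) {W : Set (E × ℝ)} (hW : IsOpen W) {U : Set E}
    (hU : IsOpen U) (hUW : ∀ y ∈ U, ∀ t ∈ Icc (0 : ℝ) 1, (y, t) ∈ W) :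
    ∀ {G : Type u} [NormedAddCommGroup G] [NormedSpace ℝ G] {F : E × ℝ → G},
      ContDiffOn ℝ ∞ F W → ContDiffOn ℝ n (fun y => ∫ t in (0 : ℝ)..1, F (y, t)) U := by
  induction n with
  | zero =>
    intro G _ _ F hF
    refine contDiffOn_zero.2 fun y hy => ?_
    exact (hasFDerivAt_integral_unitInterval hW (hF.of_le (by exact_mod_cast le_top))
      (hUW y hy)).continuousAt.continuousWithinAt
  | succ n ih =>
    intro G _ _ F hF
    have hd := fun y hy => hasFDerivAt_integral_unitInterval hW
      (hF.of_le (by exact_mod_cast le_top)) (hUW y hy)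
    rw [Nat.cast_add, Nat.cast_one, contDiffOn_succ_iff_fderiv_of_isOpen hU]
    refine ⟨fun y hy => (hd y hy).differentiableAt.differentiableWithinAt, by simp, ?_⟩
    refine (ih (F := fun p => (fderiv ℝ F p).comp (ContinuousLinearMap.inl ℝ E ℝ)) ?_).congr
      fun y hy => (hd y hy).fderiv
    exact (hF.fderiv_of_isOpen hW (by simp)).clm_comp contDiffOn_const

open Set in
lemma contDiffOn_integral_unitInterval {G : Type u} [NormedAddCommGroup G] [NormedSpace ℝ G]
    {W : Set (E × ℝ)} (hW : IsOpen W) {U : Set E}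
    (hU : IsOpen U) (hUW : ∀ y ∈ U, ∀ t ∈ Icc (0 : ℝ) 1, (y, t) ∈ W) {F : E × ℝ → G}
    (hF : ContDiffOn ℝ ∞ F W) : ContDiffOn ℝ ∞ (fun y => ∫ t in (0 : ℝ)..1, F (y, t)) U :=
  contDiffOn_infty.2 fun n => contDiffOn_nat_integral_unitInterval n hW hU hUW hF

/-- Derivative at the centre of the radial integral of a family of linear maps. -/
lemma hasFDerivAt_integral_radial {G : Type*} [NormedAddCommGroup G] [NormedSpace ℝ G]
    [CompleteSpace G] {U : Set E} (hU : IsOpen U) {B : E → E →L[ℝ] G} (hB : ContDiffOn ℝ 1 B U)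
    {c : E} (hc : c ∈ U) {w : ℝ → ℝ} (hw : ContDiff ℝ 1 w) :
    HasFDerivAt (fun y => ∫ t in (0 : ℝ)..1, w t • B (c + t • (y - c)) (y - c))
      ((∫ t in (0 : ℝ)..1, w t) • B c) c := by
  have hm : ContDiff ℝ 1 (fun p : E × ℝ => c + p.2 • (p.1 - c)) := by fun_prop
  have hW : IsOpen {p : E × ℝ | c + p.2 • (p.1 - c) ∈ U} := hU.preimage hm.continuous
  have hF : ContDiffOn ℝ 1 (fun p : E × ℝ => w p.2 • B (c + p.2 • (p.1 - c)) (p.1 - c))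
      {p : E × ℝ | c + p.2 • (p.1 - c) ∈ U} :=
    (hw.comp contDiff_snd).contDiffOn.smul ((hB.comp hm.contDiffOn fun p hp => hp).clm_apply
      (contDiff_fst.sub contDiff_const).contDiffOn)
  refine (hasFDerivAt_integral_unitInterval hW hF (x := c) (by simp [hc])).congr_fderiv ?_
  refine Eq.trans ?_ (intervalIntegral.integral_smul_const (𝕜 := ℝ) w (B c))
  refine intervalIntegral.integral_congr fun t _ => ?_
  have hd : DifferentiableAt ℝ (fun p : E × ℝ => w p.2 • B (c + p.2 • (p.1 - c)) (p.1 - c))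
      (c, t) := (hF.contDiffAt (hW.mem_nhds (by simp [hc]))).differentiableAt one_ne_zero
  have h3 := HasFDerivAt.comp c hd.hasFDerivAt (hasFDerivAt_prodMk_left (𝕜 := ℝ) c t)
  have hBd : DifferentiableAt ℝ (fun y => B (c + t • (y - c))) c := by
    have : DifferentiableAt ℝ B (c + t • (c - c)) := by
      simpa using (hB.contDiffAt (hU.mem_nhds hc)).differentiableAt one_ne_zero
    exact DifferentiableAt.comp (g := B) (f := fun y : E => c + t • (y - c)) c this (by fun_prop)
  have h4 : HasFDerivAt (fun y : E => y - c) (ContinuousLinearMap.id ℝ E) c :=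
    (hasFDerivAt_id c).sub_const c
  refine (h3.unique ((hBd.hasFDerivAt.clm_apply h4).const_smul (w t))).trans ?_
  ext v
  simp

end ParametricIntegral

section RadialPrimitive

variable {E : Type*} [NormedAddCommGroup E] [NormedSpace ℝ E]

/-- A 2-form on a normed space, curried. -/
def curryTwo : (E [⋀^Fin 2]→L[ℝ] ℝ) →L[ℝ] E →L[ℝ] E →L[ℝ] ℝ :=
  ((ContinuousLinearMap.compL ℝ E (E [⋀^Fin 1]→L[ℝ] ℝ) (E →L[ℝ] ℝ)
    ((ContinuousAlternatingMap.ofSubsingletonLIE (𝕜 := ℝ) (E := E) (F := ℝ)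
      (0 : Fin 1)).symm.toContinuousLinearEquiv.toContinuousLinearMap))).comp
    (ContinuousAlternatingMap.curryLeftLI (𝕜 := ℝ) (E := E) (F := ℝ)
      (n := 1)).toContinuousLinearMap

lemma contDiff_curryTwo : ContDiff ℝ ∞ (curryTwo (E := E)) :=
  ContinuousLinearMap.contDiff _

@[simp]
lemma curryTwo_apply (A : E [⋀^Fin 2]→L[ℝ] ℝ) (v w : E) : curryTwo A v w = A ![v, w] := by
  have : (ContinuousAlternatingMap.ofSubsingletonLIE (𝕜 := ℝ) (E := E) (F := ℝ) (0 : Fin 1)).symm (A.curryLeft v) w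
      = A ![v, w] := by
    have h := congrArg (fun g : E [⋀^Fin 1]→L[ℝ] ℝ => g ![w])
      ((ContinuousAlternatingMap.ofSubsingletonLIE (𝕜 := ℝ) (E := E) (F := ℝ) (0 : Fin 1)).apply_symm_apply
        (A.curryLeft v))
    exact h
  exact this

lemma alternating_two_swap (A : E [⋀^Fin 2]→L[ℝ] ℝ) (v w : E) : A ![v, w] = -A ![w, v] := by
  have h := A.toAlternatingMap.map_swap ![w, v] (i := 0) (j := 1) (by decide)
  have h2 : (![w, v] ∘ Equiv.swap (0 : Fin 2) 1) = ![v, w] := by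
    funext i; fin_cases i <;> simp
  rw [h2] at h
  exact h

/-- The primitive of a 2-form given by the radial homotopy operator centred at `c`. -/
def radialPrimitive (A : E → E [⋀^Fin 2]→L[ℝ] ℝ) (c y : E) : E →L[ℝ] ℝ :=
  ∫ u in (0 : ℝ)..1, u • curryTwo (A (c + u • (y - c))) (y - c)

lemma add_smul_sub_mem_ball {c y : E} {r u : ℝ} (hy : y ∈ Metric.ball c r)
    (hu : u ∈ Set.Icc (0 : ℝ) 1) : c + u • (y - c) ∈ Metric.ball c r :=
  (convex_ball c r).add_smul_sub_mem
    (Metric.mem_ball_self (Metric.pos_of_mem_ball hy)) hy hu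

variable {A : E → E [⋀^Fin 2]→L[ℝ] ℝ} {c : E} {r : ℝ}

lemma contDiffOn_radialIntegrand (hA : ContDiffOn ℝ ∞ A (Metric.ball c r)) :
    ContDiffOn ℝ ∞ (fun p : E × ℝ => p.2 • curryTwo (A (c + p.2 • (p.1 - c))) (p.1 - c))
      {p : E × ℝ | c + p.2 • (p.1 - c) ∈ Metric.ball c r} := by
  have h1 : ContDiff ℝ ∞ (fun p : E × ℝ => c + p.2 • (p.1 - c)) := by fun_prop
  have h2 : ContDiffOn ℝ ∞ (fun p : E × ℝ => A (c + p.2 • (p.1 - c)))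
      {p : E × ℝ | c + p.2 • (p.1 - c) ∈ Metric.ball c r} :=
    hA.comp h1.contDiffOn fun p hp => hp
  have h3 : ContDiffOn ℝ ∞ (fun p : E × ℝ => curryTwo (A (c + p.2 • (p.1 - c))))
      {p : E × ℝ | c + p.2 • (p.1 - c) ∈ Metric.ball c r} :=
    contDiff_curryTwo.comp_contDiffOn h2
  exact contDiff_snd.contDiffOn.smul
    (h3.clm_apply (contDiff_fst.sub contDiff_const).contDiffOn)

lemma isOpen_radialDomain : IsOpen {p : E × ℝ | c + p.2 • (p.1 - c) ∈ Metric.ball c r} :=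
  Metric.isOpen_ball.preimage (by fun_prop)

lemma radialPrimitive_apply (hA : ContDiffOn ℝ ∞ A (Metric.ball c r)) {y : E}
    (hy : y ∈ Metric.ball c r) (v : E) :
    radialPrimitive A c y v =
      ∫ u in (0 : ℝ)..1, u * A (c + u • (y - c)) ![y - c, v] := by
  have hc : ContinuousOn (fun u : ℝ => u • curryTwo (A (c + u • (y - c))) (y - c))
      (Set.uIcc 0 1) := by
    refine (contDiffOn_radialIntegrand hA).continuousOn.comp
      (f := fun u : ℝ => (y, u)) (by fun_prop) fun u hu => ?_
    rw [Set.uIcc_of_le zero_le_one] at hu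
    exact add_smul_sub_mem_ball hy hu
  rw [radialPrimitive, ContinuousLinearMap.intervalIntegral_apply hc.intervalIntegrable]
  simp

@[simp]
lemma radialPrimitive_self : radialPrimitive A c c = 0 := by simp [radialPrimitive]

variable [FiniteDimensional ℝ E]

lemma contDiffOn_radialPrimitive (hA : ContDiffOn ℝ ∞ A (Metric.ball c r)) :
    ContDiffOn ℝ ∞ (radialPrimitive A c) (Metric.ball c r) :=
  contDiffOn_integral_unitInterval isOpen_radialDomain Metric.isOpen_ball
    (fun _ hy _ ht => add_smul_sub_mem_ball hy ht) (contDiffOn_radialIntegrand hA)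

lemma hasFDerivAt_radialPrimitive (hr : 0 < r) (hA : ContDiffOn ℝ ∞ A (Metric.ball c r)) :
    HasFDerivAt (radialPrimitive A c) ((1 / 2 : ℝ) • curryTwo (A c)) c := by
  have h := hasFDerivAt_integral_radial Metric.isOpen_ball (B := fun y => curryTwo (A y))
    ((contDiff_curryTwo.comp_contDiffOn hA).of_le (by exact_mod_cast le_top))
    (Metric.mem_ball_self hr) (w := fun t => t) contDiff_id
  rw [integral_id, show ((1 : ℝ) ^ 2 - 0 ^ 2) / 2 = 1 / 2 by norm_num] at h
  exact h

end RadialPrimitive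

section Cutoff

/-- A smooth monotone cutoff, equal to `0` near `0` and to `1` near `1`. -/
def cutoff (t : ℝ) : ℝ := Real.smoothTransition (3 * t - 1)

lemma contDiff_cutoff : ContDiff ℝ ∞ cutoff :=
  Real.smoothTransition.contDiff.comp (by fun_prop)

lemma cutoff_mem (t : ℝ) : cutoff t ∈ Set.Icc (0 : ℝ) 1 :=
  ⟨Real.smoothTransition.nonneg _, Real.smoothTransition.le_one _⟩

lemma cutoff_of_le {t : ℝ} (ht : t ≤ 1 / 3) : cutoff t = 0 :=
  Real.smoothTransition.zero_of_nonpos (by linarith)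

@[simp]
lemma cutoff_zero : cutoff 0 = 0 := cutoff_of_le (by norm_num)

@[simp]
lemma cutoff_one : cutoff 1 = 1 := Real.smoothTransition.one_of_one_le (by norm_num)

/-- Change of variables along the cutoff. -/
lemma integral_comp_cutoff {f : ℝ → ℝ} (hf : ContinuousOn f (Set.Icc 0 1)) :
    ∫ t in (0 : ℝ)..1, f (cutoff t) * deriv cutoff t = ∫ t in (0 : ℝ)..1, f t := by
  have h := intervalIntegral.integral_comp_mul_deriv' (a := 0) (b := 1) (f := cutoff)
    (f' := deriv cutoff) (g := f)
    (fun x _ => (contDiff_cutoff.differentiable (by simp) x).hasDerivAt)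
    (contDiff_cutoff.continuous_deriv (by simp)).continuousOn
    (hf.mono (by rintro _ ⟨t, -, rfl⟩; exact cutoff_mem t))
  simpa using h

end Cutoff

section Duffy

open MeasureTheory Set

/-- Integration over the coordinate triangle in the coordinates `r = t₀ + t₁`,
`s = t₁ / (t₀ + t₁)`. -/
lemma setIntegral_triangle {Q : ℝ → ℝ → ℝ} (hQ : Continuous (Function.uncurry Q)) :
    ∫ t in {t : Fin 2 → ℝ | (∀ i, 0 < t i) ∧ ∑ i, t i < 1},
        (t 0 + t 1)⁻¹ * Q (t 0 + t 1) (t 1 / (t 0 + t 1))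
      = ∫ s in (0 : ℝ)..1, ∫ r in (0 : ℝ)..1, Q r s := by
  let D : Set (Fin 2 → ℝ) := {x | x 0 ∈ Ioo (0 : ℝ) 1 ∧ x 1 ∈ Ioo (0 : ℝ) 1}
  let f : (Fin 2 → ℝ) → (Fin 2 → ℝ) := fun x => ![x 1 * (1 - x 0), x 1 * x 0]
  let f' : (Fin 2 → ℝ) → (Fin 2 → ℝ) →L[ℝ] (Fin 2 → ℝ) := fun x =>
    LinearMap.toContinuousLinearMap (Matrix.toLin' !![-x 1, 1 - x 0; x 1, x 0])
  have hD : MeasurableSet D :=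
    (measurableSet_Ioo.preimage (measurable_pi_apply 0)).inter
      (measurableSet_Ioo.preimage (measurable_pi_apply 1))
  have hdet : ∀ x, (f' x).det = -x 1 := by
    intro x
    change LinearMap.det (Matrix.toLin' !![-x 1, 1 - x 0; x 1, x 0]) = _
    rw [LinearMap.det_toLin', Matrix.det_fin_two_of]
    ring
  have hf' : ∀ x ∈ D, HasFDerivWithinAt f (f' x) D x := by
    intro x _
    refine HasFDerivAt.hasFDerivWithinAt ?_
    have h0 : HasFDerivAt (fun x : Fin 2 → ℝ => x 0) (ContinuousLinearMap.proj (R := ℝ) 0) x :=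
      hasFDerivAt_apply 0 x
    have h1 : HasFDerivAt (fun x : Fin 2 → ℝ => x 1) (ContinuousLinearMap.proj (R := ℝ) 1) x :=
      hasFDerivAt_apply 1 x
    refine hasFDerivAt_pi'' fun i => ?_
    fin_cases i
    · refine (h1.mul ((hasFDerivAt_const (1 : ℝ) x).sub h0)).congr_fderiv ?_
      ext v
      simp [f', Matrix.toLin'_apply, dotProduct, Fin.sum_univ_two]
    · refine (h1.mul h0).congr_fderiv ?_
      ext v
      simp [f', Matrix.toLin'_apply, dotProduct, Fin.sum_univ_two]
  have hsum : ∀ x, f x 0 + f x 1 = x 1 := fun x => by simp [f]; ring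
  have hinj : InjOn f D := by
    intro x hx y hy hxy
    have e1 : x 1 = y 1 := by rw [← hsum x, ← hsum y, hxy]
    have e0 : x 1 * x 0 = y 1 * y 0 := congrFun hxy 1
    rw [← e1] at e0
    have e0' := mul_left_cancel₀ hx.2.1.ne' e0
    funext i
    fin_cases i
    exacts [e0', e1]
  have himg : f '' D = {t : Fin 2 → ℝ | (∀ i, 0 < t i) ∧ ∑ i, t i < 1} := by
    ext t
    simp only [mem_image, mem_ofPred_eq, Fin.forall_fin_two, Fin.sum_univ_two]
    constructor
    · rintro ⟨x, ⟨hx0, hx1⟩, rfl⟩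
      refine ⟨⟨mul_pos hx1.1 (by linarith [hx0.2]), mul_pos hx1.1 hx0.1⟩, ?_⟩
      rw [hsum]; exact hx1.2
    · rintro ⟨⟨h0, h1⟩, h⟩
      have hp : 0 < t 0 + t 1 := by positivity
      refine ⟨![t 1 / (t 0 + t 1), t 0 + t 1], ⟨⟨by simp; positivity, ?_⟩, ⟨by simpa, by simpa⟩⟩, ?_⟩
      · simp only [Matrix.cons_val_zero]
        rw [div_lt_one hp]; linarith
      · funext i
        fin_cases i
        · simp [f]; field_simp; ring
        · simp [f]; field_simp
  rw [← himg, integral_image_eq_integral_abs_det_fderiv_smul volume hD hf' hinj]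
  have hcongr : ∀ x ∈ D, |(f' x).det| • ((f x 0 + f x 1)⁻¹ *
      Q (f x 0 + f x 1) (f x 1 / (f x 0 + f x 1))) = Q (x 1) (x 0) := by
    intro x hx
    have hx1 : x 1 ≠ 0 := hx.2.1.ne'
    rw [hdet, hsum, abs_neg, abs_of_pos hx.2.1, smul_eq_mul, mul_inv_cancel_left₀ hx1]
    congr 1
    simp [f]
    field_simp
  rw [setIntegral_congr_fun hD hcongr]
  have hpre : D = (MeasurableEquiv.finTwoArrow (α := ℝ)) ⁻¹' (Ioo (0 : ℝ) 1 ×ˢ Ioo (0 : ℝ) 1) := by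
    ext x; simp [D, MeasurableEquiv.finTwoArrow]
  have htrans := (volume_preserving_finTwoArrow ℝ).setIntegral_preimage_emb
    (MeasurableEquiv.finTwoArrow (α := ℝ)).measurableEmbedding (fun p : ℝ × ℝ => Q p.2 p.1)
    (Ioo (0 : ℝ) 1 ×ˢ Ioo (0 : ℝ) 1)
  rw [hpre]
  refine htrans.trans ?_
  have hcont : Continuous (fun p : ℝ × ℝ => Q p.2 p.1) := hQ.comp continuous_swap
  rw [Measure.volume_eq_prod, setIntegral_prod _
    ((hcont.continuousOn.integrableOn_compact (isCompact_Icc.prod isCompact_Icc)).mono_set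
      (prod_mono Ioo_subset_Icc_self Ioo_subset_Icc_self))]
  simp only [intervalIntegral.integral_of_le zero_le_one, integral_Ioc_eq_integral_Ioo]

end Duffy

section Phase

/-- The character `t ↦ exp(2πit)` of `ℝ`, with values in `ℂ`. -/
def phase (t : ℝ) : ℂ := Complex.exp (2 * Real.pi * Complex.I * t)

lemma phase_add (s t : ℝ) : phase (s + t) = phase s * phase t := by
  rw [phase, phase, phase, ← Complex.exp_add]
  push_cast
  ring_nf

@[simp]
lemma phase_zero : phase 0 = 1 := by simp [phase]

lemma phase_ne_zero (t : ℝ) : phase t ≠ 0 := Complex.exp_ne_zero _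

@[simp]
lemma phase_intCast (k : ℤ) : phase k = 1 := by
  rw [phase, Complex.exp_eq_one_iff]
  exact ⟨k, by push_cast; ring⟩

lemma phase_add_intCast (t : ℝ) (k : ℤ) : phase (t + k) = phase t := by
  rw [phase_add, phase_intCast, mul_one]

lemma hasDerivAt_phase (t : ℝ) : HasDerivAt phase (2 * Real.pi * Complex.I * phase t) t := by
  have h : HasDerivAt (fun s : ℝ => 2 * Real.pi * Complex.I * (s : ℂ))
      (2 * Real.pi * Complex.I * 1) t := (Complex.ofRealCLM.hasDerivAt (x := t)).const_mul _
  refine h.cexp.congr_deriv ?_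
  rw [phase]; ring

variable {V : Type*} [NormedAddCommGroup V] [NormedSpace ℝ V] [FiniteDimensional ℝ V]
  {U : Set V} {G : V → ℂ} {κ : V → V →L[ℝ] ℝ}

/-- The derivative of a function whose values change along segments by the phase of the integral of
a 1-form. -/
lemma hasFDerivAt_of_phase_integral (hU : IsOpen U) (hκ : ContDiffOn ℝ ∞ κ U)
    (hG : ∀ x y, (∀ t ∈ Set.Icc (0 : ℝ) 1, x + t • (y - x) ∈ U) →
      G y = G x * phase (∫ t in (0 : ℝ)..1, κ (x + t • (y - x)) (y - x))) {x : V} (hx : x ∈ U) :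
    HasFDerivAt G ((2 * Real.pi * Complex.I * G x) • Complex.ofRealCLM.comp (κ x)) x := by
  have h1 := hasFDerivAt_integral_radial hU (hκ.of_le (by exact_mod_cast le_top)) hx
    (w := fun _ => 1) contDiff_const
  simp only [one_smul, intervalIntegral.integral_const, sub_zero] at h1
  have h2 := ((hasDerivAt_phase _).hasFDerivAt.comp x h1).const_mul (G x)
  obtain ⟨r, hr, hrU⟩ := Metric.isOpen_iff.1 hU x hx
  refine (h2.congr_of_eventuallyEq ?_).congr_fderiv ?_
  · filter_upwards [Metric.ball_mem_nhds x hr] with y hy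
    exact hG x y fun t ht => hrU (add_smul_sub_mem_ball hy ht)
  · ext v
    simp
    ring

lemma contDiffOn_of_phase_integral (hU : IsOpen U) (hκ : ContDiffOn ℝ ∞ κ U)
    (hG : ∀ x y, (∀ t ∈ Set.Icc (0 : ℝ) 1, x + t • (y - x) ∈ U) →
      G y = G x * phase (∫ t in (0 : ℝ)..1, κ (x + t • (y - x)) (y - x))) :
    ContDiffOn ℝ ∞ G U := by
  have hd := fun x hx => hasFDerivAt_of_phase_integral hU hκ hG (x := x) hx
  refine contDiffOn_infty.2 fun n => ?_
  induction n with
  | zero => exact contDiffOn_zero.2 fun x hx => (hd x hx).continuousAt.continuousWithinAt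
  | succ n ih =>
    rw [Nat.cast_add, Nat.cast_one, contDiffOn_succ_iff_fderiv_of_isOpen hU]
    refine ⟨fun x hx => (hd x hx).differentiableAt.differentiableWithinAt, by simp, ?_⟩
    refine ContDiffOn.congr ?_ fun x hx => (hd x hx).fderiv
    exact (contDiffOn_const.mul ih).smul
      (contDiffOn_const.clm_comp (hκ.of_le (by exact_mod_cast le_top)))

end Phase

section Pullback

variable {E : Type*} [NormedAddCommGroup E] [NormedSpace ℝ E]
  {H : Type*} [TopologicalSpace H] {I : ModelWithCorners ℝ E H}
  {M : Type*} [TopologicalSpace M] [ChartedSpace H M]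
  {E' : Type*} [NormedAddCommGroup E'] [NormedSpace ℝ E']
  {H' : Type*} [TopologicalSpace H'] {I' : ModelWithCorners ℝ E' H'}
  {M' : Type*} [TopologicalSpace M'] [ChartedSpace H' M']
  {E'' : Type*} [NormedAddCommGroup E''] [NormedSpace ℝ E'']
  {H'' : Type*} [TopologicalSpace H''] {I'' : ModelWithCorners ℝ E'' H''}
  {M'' : Type*} [TopologicalSpace M''] [ChartedSpace H'' M'']
  {n : ℕ}

lemma pullback_congr (Ω : DiffForm I M n) {f g : M' → M} {x : M'} (h : f =ᶠ[𝓝 x] g) :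
    DiffForm.pullback (I' := I') f Ω x = DiffForm.pullback (I' := I') g Ω x := by
  have key : ∀ (p q : M) (_ : p = q) (L : TangentSpace I' x →L[ℝ] TangentSpace I p)
      (L' : TangentSpace I' x →L[ℝ] TangentSpace I q) (_ : ∀ v, (L v : E) = (L' v : E)),
      (Ω p).compContinuousLinearMap L = (Ω q).compContinuousLinearMap L' := by
    rintro p _ rfl L L' hL
    rw [show L = L' from ContinuousLinearMap.ext hL]
  have h2 : (mfderiv I' I f x : E' →L[ℝ] E) = mfderiv I' I g x := h.mfderiv_eq
  exact key _ _ h.self_of_nhds _ _ fun v => congrArg (fun L : E' →L[ℝ] E => L v) h2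

lemma pullback_comp (Ω : DiffForm I M n) {g : M' → M} {f : M'' → M'} {x : M''}
    (hg : MDifferentiableAt I' I g (f x)) (hf : MDifferentiableAt I'' I' f x) :
    DiffForm.pullback (I' := I'') (g ∘ f) Ω x =
      DiffForm.pullback (I' := I'') f (DiffForm.pullback (I' := I') g Ω) x := by
  simp only [DiffForm.pullback, mfderiv_comp x hg hf]
  rfl

end Pullback

section Simplices

variable {E : Type*} [NormedAddCommGroup E] [NormedSpace ℝ E]
  {M : Type*} [TopologicalSpace M] [ChartedSpace E M]

lemma SmoothSimplex.ext' {n : ℕ} {σ τ : SmoothSimplex 𝓘(ℝ, E) M n}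
    (h : ∀ t, σ.toFun t = τ.toFun t) : σ = τ := by
  cases σ; cases τ
  congr
  exact funext h

/-- The simplex given by the restriction of a smooth map on the ambient vector space. -/
def SmoothSimplex.ofMap {n : ℕ} (F : (Fin (n + 1) → ℝ) → M)
    (hF : ContMDiff 𝓘(ℝ, Fin (n + 1) → ℝ) 𝓘(ℝ, E) ∞ F) : SmoothSimplex 𝓘(ℝ, E) M n where
  toFun t := F t
  smooth := ⟨Set.univ, F, isOpen_univ, Set.subset_univ _, hF.contMDiffOn, fun _ => rfl⟩

/-- The singular 1-simplex given by the restriction to `[0, 1]` of a smooth curve. -/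
def SmoothSimplex.ofCurve (γ : ℝ → M) (hγ : ContMDiff 𝓘(ℝ, ℝ) 𝓘(ℝ, E) ∞ γ) :
    SmoothSimplex 𝓘(ℝ, E) M 1 :=
  SmoothSimplex.ofMap (fun t => γ (t 1)) (hγ.comp (contDiff_apply ℝ ℝ (1 : Fin 2)).contMDiff)

open Classical in
/-- The value of a 1-cochain on a smooth curve, restricted to `[0, 1]`. -/
def onCurve (b : SmoothSimplex 𝓘(ℝ, E) M 1 → ℝ) (γ : ℝ → M) : ℝ :=
  if h : ContMDiff 𝓘(ℝ, ℝ) 𝓘(ℝ, E) ∞ γ then b (SmoothSimplex.ofCurve γ h) else 0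

lemma onCurve_eq (b : SmoothSimplex 𝓘(ℝ, E) M 1 → ℝ) {γ : ℝ → M}
    (h : ContMDiff 𝓘(ℝ, ℝ) 𝓘(ℝ, E) ∞ γ) : onCurve b γ = b (SmoothSimplex.ofCurve γ h) :=
  dif_pos h

end Simplices

section Cone

variable {E : Type*} [NormedAddCommGroup E] [NormedSpace ℝ E]

/-- The cone with apex `c` over a curve, parametrized so as to be smooth at the apex. -/
def cone (c : E) (g : ℝ → E) (a b : ℝ) : E := c + cutoff (a + b) • (g (b / (a + b)) - c)

variable {c : E} {g : ℝ → E}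

lemma contDiff_cone (hg : ContDiff ℝ ∞ g) : ContDiff ℝ ∞ (fun p : ℝ × ℝ => cone c g p.1 p.2) := by
  refine contDiff_iff_contDiffAt.2 fun p => ?_
  by_cases hp : p.1 + p.2 < 1 / 3
  · have : (fun p : ℝ × ℝ => cone c g p.1 p.2) =ᶠ[𝓝 p] fun _ => c := by
      have ho : IsOpen {p : ℝ × ℝ | p.1 + p.2 < 1 / 3} :=
        isOpen_lt (by fun_prop) continuous_const
      filter_upwards [ho.mem_nhds hp] with q hq
      rw [cone, cutoff_of_le hq.le, zero_smul, add_zero]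
    exact contDiffAt_const.congr_of_eventuallyEq this
  · have hne : p.1 + p.2 ≠ 0 := by intro h; rw [h] at hp; norm_num at hp
    have h1 : ContDiffAt ℝ ∞ (fun p : ℝ × ℝ => p.1 + p.2) p := by fun_prop
    have h2 : ContDiffAt ℝ ∞ (fun p : ℝ × ℝ => p.2 / (p.1 + p.2)) p :=
      contDiffAt_snd.div h1 hne
    exact contDiffAt_const.add ((contDiff_cutoff.contDiffAt.comp p h1).smul
      ((hg.contDiffAt.comp p h2).sub contDiffAt_const))

lemma cone_mem_ball {r : ℝ} (hg : ∀ t, g t ∈ Metric.ball c r) (a b : ℝ) :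
    cone c g a b ∈ Metric.ball c r :=
  add_smul_sub_mem_ball (hg _) (cutoff_mem _)

lemma hasDerivAt_cone (hg : ContDiff ℝ ∞ g) {a b : ℝ} (h : 0 < a + b) (v w : ℝ) :
    HasDerivAt (fun τ : ℝ => cone c g (a + τ * v) (b + τ * w))
      ((deriv cutoff (a + b) * (v + w)) • (g (b / (a + b)) - c) +
        (cutoff (a + b) * ((w * (a + b) - b * (v + w)) / (a + b) ^ 2)) •
          deriv g (b / (a + b))) 0 := by
  have hb : HasDerivAt (fun τ : ℝ => b + τ * w) w 0 := by
    simpa using ((hasDerivAt_id (0 : ℝ)).mul_const w).const_add b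
  have ha : HasDerivAt (fun τ : ℝ => a + τ * v) v 0 := by
    simpa using ((hasDerivAt_id (0 : ℝ)).mul_const v).const_add a
  have hr : HasDerivAt (fun τ : ℝ => a + τ * v + (b + τ * w)) (v + w) 0 := ha.add hb
  have hs : HasDerivAt (fun τ : ℝ => (b + τ * w) / (a + τ * v + (b + τ * w)))
      ((w * (a + b) - b * (v + w)) / (a + b) ^ 2) 0 := by
    refine (hb.fun_div hr (by simpa using h.ne')).congr_deriv ?_
    simp
  have hg' : HasDerivAt g (deriv g (b / (a + b))) ((b + 0 * w) / (a + 0 * v + (b + 0 * w))) := by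
    simpa using (hg.differentiable (by simp) (b / (a + b))).hasDerivAt
  have hc' : HasDerivAt cutoff (deriv cutoff (a + b)) (a + 0 * v + (b + 0 * w)) := by
    simpa using (contDiff_cutoff.differentiable (by simp) (a + b)).hasDerivAt
  have h1 := (hg'.scomp (0 : ℝ) hs).sub_const c
  have h2 := HasDerivAt.comp (0 : ℝ) hc' hr
  refine ((h2.smul h1).const_add c).congr_deriv ?_
  simp only [Function.comp_apply, zero_mul, add_zero, smul_smul]
  rw [add_comm]

lemma form_fderiv_cone (A : E [⋀^Fin 2]→L[ℝ] ℝ) (hg : ContDiff ℝ ∞ g) {t : Fin 2 → ℝ}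
    (h : 0 < t 0 + t 1) :
    A.compContinuousLinearMap (fderiv ℝ (fun t : Fin 2 → ℝ => cone c g (t 0) (t 1)) t)
        (fun i => (Pi.single i 1 : Fin 2 → ℝ)) =
      (t 0 + t 1)⁻¹ * (cutoff (t 0 + t 1) * deriv cutoff (t 0 + t 1) *
        A ![g (t 1 / (t 0 + t 1)) - c, deriv g (t 1 / (t 0 + t 1))]) := by
  have hd : DifferentiableAt ℝ (fun t : Fin 2 → ℝ => cone c g (t 0) (t 1)) t :=
    ((contDiff_cone hg).differentiable (by simp) (t 0, t 1)).comp
      (f := fun t : Fin 2 → ℝ => (t 0, t 1)) t (by fun_prop)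
  have hline : ∀ v : Fin 2 → ℝ, fderiv ℝ (fun t : Fin 2 → ℝ => cone c g (t 0) (t 1)) t v =
      (deriv cutoff (t 0 + t 1) * (v 0 + v 1)) • (g (t 1 / (t 0 + t 1)) - c) +
        (cutoff (t 0 + t 1) * ((v 1 * (t 0 + t 1) - t 1 * (v 0 + v 1)) / (t 0 + t 1) ^ 2)) •
          deriv g (t 1 / (t 0 + t 1)) := by
    intro v
    have h1 : HasDerivAt (fun τ : ℝ => t + τ • v) v 0 := by
      simpa using ((hasDerivAt_id (0 : ℝ)).smul_const v).const_add t
    have h2 : HasFDerivAt (fun t : Fin 2 → ℝ => cone c g (t 0) (t 1))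
      (fderiv ℝ (fun t : Fin 2 → ℝ => cone c g (t 0) (t 1)) t) (t + (0 : ℝ) • v) := by
      simpa using hd.hasFDerivAt
    have h3 := HasFDerivAt.comp_hasDerivAt (0 : ℝ) h2 h1
    exact h3.unique (hasDerivAt_cone hg h (v 0) (v 1))
  rw [ContinuousAlternatingMap.compContinuousLinearMap_apply]
  have hvec : (⇑(fderiv ℝ (fun t : Fin 2 → ℝ => cone c g (t 0) (t 1)) t) ∘
      fun i => (Pi.single i 1 : Fin 2 → ℝ)) =
      ![fderiv ℝ (fun t : Fin 2 → ℝ => cone c g (t 0) (t 1)) t (Pi.single 0 1),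
        fderiv ℝ (fun t : Fin 2 → ℝ => cone c g (t 0) (t 1)) t (Pi.single 1 1)] := by
    funext i; fin_cases i <;> rfl
  rw [hvec, hline, hline]
  generalize g (t 1 / (t 0 + t 1)) - c = X
  generalize deriv g (t 1 / (t 0 + t 1)) = Y
  have hXX : ∀ Z : E, A ![Z, Z] = 0 := fun Z =>
    A.map_eq_zero_of_eq ![Z, Z] (i := 0) (j := 1) rfl (by decide)
  have hYX := alternating_two_swap A Y X
  simp only [← curryTwo_apply] at hXX hYX ⊢
  simp only [map_add, map_smul, add_apply, smul_apply,
    smul_eq_mul, hXX, hYX, Pi.single_eq_same, ne_eq, zero_ne_one, one_ne_zero, not_false_eq_true,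
    Pi.single_eq_of_ne]
  field_simp
  ring

end Cone

section ChartBall

variable (E : Type*) [NormedAddCommGroup E] [NormedSpace ℝ E]
  {M : Type*} [TopologicalSpace M] [ChartedSpace E M]

lemma exists_ball_subset_target (x₀ : M) :
    ∃ r > 0, Metric.ball (extChartAt 𝓘(ℝ, E) x₀ x₀) r ⊆ (extChartAt 𝓘(ℝ, E) x₀).target :=
  Metric.mem_nhds_iff.1 (extChartAt_target_mem_nhds x₀)

/-- The image under the preferred chart at `x₀` of the point `x₀`. -/
def chartCenter (x₀ : M) : E := extChartAt 𝓘(ℝ, E) x₀ x₀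

/-- The radius of a ball contained in the target of the preferred chart at `x₀`. -/
def chartRadius (x₀ : M) : ℝ := (exists_ball_subset_target E x₀).choose

/-- A ball around `chartCenter` contained in the target of the preferred chart at `x₀`. -/
def chartBall (x₀ : M) : Set E := Metric.ball (chartCenter E x₀) (chartRadius E x₀)

/-- The open set of `M` parametrized by `chartBall`. -/
def ballNhd (x₀ : M) : Set M :=
  (extChartAt 𝓘(ℝ, E) x₀).source ∩ extChartAt 𝓘(ℝ, E) x₀ ⁻¹' chartBall E x₀

lemma chartRadius_pos (x₀ : M) : 0 < chartRadius E x₀ :=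
  (exists_ball_subset_target E x₀).choose_spec.1

lemma chartBall_subset (x₀ : M) : chartBall E x₀ ⊆ (extChartAt 𝓘(ℝ, E) x₀).target :=
  (exists_ball_subset_target E x₀).choose_spec.2

lemma chartCenter_mem (x₀ : M) : chartCenter E x₀ ∈ chartBall E x₀ :=
  Metric.mem_ball_self (chartRadius_pos E x₀)

lemma isOpen_chartBall (x₀ : M) : IsOpen (chartBall E x₀) := Metric.isOpen_ball

lemma mem_ballNhd_self (x₀ : M) : x₀ ∈ ballNhd E x₀ :=
  ⟨mem_extChartAt_source x₀, chartCenter_mem E x₀⟩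

lemma isOpen_ballNhd (x₀ : M) : IsOpen (ballNhd E x₀) :=
  (continuousOn_extChartAt x₀).isOpen_inter_preimage (isOpen_extChartAt_source x₀)
    (isOpen_chartBall E x₀)

variable {E}

lemma symm_mem_ballNhd {x₀ : M} {y : E} (hy : y ∈ chartBall E x₀) :
    (extChartAt 𝓘(ℝ, E) x₀).symm y ∈ ballNhd E x₀ := by
  have ht := chartBall_subset E x₀ hy
  refine ⟨(extChartAt 𝓘(ℝ, E) x₀).map_target ht, ?_⟩
  rw [Set.mem_preimage, (extChartAt 𝓘(ℝ, E) x₀).right_inv ht]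
  exact hy

variable [IsManifold 𝓘(ℝ, E) ∞ M]

lemma contMDiffOn_symm_chartBall (x₀ : M) :
    ContMDiffOn 𝓘(ℝ, E) 𝓘(ℝ, E) ∞ (extChartAt 𝓘(ℝ, E) x₀).symm (chartBall E x₀) :=
  (contMDiffOn_extChartAt_symm x₀).mono (chartBall_subset E x₀)

lemma contMDiffOn_ballNhd (x₀ : M) :
    ContMDiffOn 𝓘(ℝ, E) 𝓘(ℝ, E) ∞ (extChartAt 𝓘(ℝ, E) x₀) (ballNhd E x₀) :=
  contMDiffOn_extChartAt.mono fun _ hx => by simpa using hx.1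

end ChartBall

section Potential

variable {E : Type*} [NormedAddCommGroup E] [NormedSpace ℝ E]
  {M : Type*} [TopologicalSpace M] [ChartedSpace E M]

/-- The radial primitive of `Ω` in the preferred chart at `x₀`. -/
def potential (Ω : DiffForm 𝓘(ℝ, E) M 2) (x₀ : M) : E → E →L[ℝ] ℝ :=
  radialPrimitive (DiffForm.inChart Ω x₀) (chartCenter E x₀)

/-- The curve in the preferred chart at `x₀` that runs radially from `x₀` to `y`. -/
def radialCurve (E : Type*) [NormedAddCommGroup E] [NormedSpace ℝ E] [ChartedSpace E M]
    (x₀ y : M) (t : ℝ) : M :=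
  (extChartAt 𝓘(ℝ, E) x₀).symm
    (chartCenter E x₀ + cutoff t • (extChartAt 𝓘(ℝ, E) x₀ y - chartCenter E x₀))

/-- The value of a 1-cochain on the radial curve from `x₀` to `y`. -/
def radialValue (b : SmoothSimplex 𝓘(ℝ, E) M 1 → ℝ) (x₀ y : M) : ℝ :=
  onCurve b (radialCurve E x₀ y)

variable {Ω : DiffForm 𝓘(ℝ, E) M 2}

lemma contDiffOn_inChart (hΩ : DiffForm.SmoothOn Ω Set.univ) (x₀ : M) :
    ContDiffOn ℝ ∞ (DiffForm.inChart Ω x₀) (chartBall E x₀) :=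
  (hΩ x₀).mono fun _ hy => ⟨chartBall_subset E x₀ hy, trivial⟩

lemma contDiffOn_potential [FiniteDimensional ℝ E] (hΩ : DiffForm.SmoothOn Ω Set.univ) (x₀ : M) :
    ContDiffOn ℝ ∞ (potential Ω x₀) (chartBall E x₀) :=
  contDiffOn_radialPrimitive (contDiffOn_inChart hΩ x₀)

variable [IsManifold 𝓘(ℝ, E) ∞ M]

lemma contMDiff_radialCurve {x₀ y : M} (hy : y ∈ ballNhd E x₀) :
    ContMDiff 𝓘(ℝ, ℝ) 𝓘(ℝ, E) ∞ (radialCurve E x₀ y) := by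
  have h : ContDiff ℝ ∞ (fun t => chartCenter E x₀ +
      cutoff t • (extChartAt 𝓘(ℝ, E) x₀ y - chartCenter E x₀)) :=
    contDiff_const.add (contDiff_cutoff.smul contDiff_const)
  exact (contMDiffOn_symm_chartBall x₀).comp_contMDiff h.contMDiff
    fun t => add_smul_sub_mem_ball hy.2 (cutoff_mem t)

lemma pullback_eq_of_eventuallyEq_symm {V : Type*} [NormedAddCommGroup V] [NormedSpace ℝ V]
    {n : ℕ} (Ω : DiffForm 𝓘(ℝ, E) M n) {x₀ : M} {s : V → M} {G : V → E} {t : V}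
    (hs : s =ᶠ[𝓝 t] (extChartAt 𝓘(ℝ, E) x₀).symm ∘ G) (hG : DifferentiableAt ℝ G t)
    (hGt : G t ∈ chartBall E x₀) (v : Fin n → V) :
    DiffForm.pullback (I' := 𝓘(ℝ, V)) s Ω t v =
      (DiffForm.inChart Ω x₀ (G t)).compContinuousLinearMap (fderiv ℝ G t) v := by
  have h1 : MDifferentiableAt 𝓘(ℝ, E) 𝓘(ℝ, E) (extChartAt 𝓘(ℝ, E) x₀).symm (G t) :=
    ((contMDiffOn_symm_chartBall x₀).contMDiffAt
      ((isOpen_chartBall E x₀).mem_nhds hGt)).mdifferentiableAt (by simp)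
  rw [pullback_congr Ω hs, pullback_comp Ω h1 hG.mdifferentiableAt]
  simp only [DiffForm.pullback, DiffForm.inChart, mfderiv_eq_fderiv]
  rfl

/-- The integral of the radial potential along a smooth curve in a chart ball, in terms of a
1-cochain whose coboundary represents the periods of the form modulo integers. -/
lemma integral_potential_curve (hΩ : DiffForm.SmoothOn Ω Set.univ)
    {b : SmoothSimplex 𝓘(ℝ, E) M 1 → ℝ}
    (hb : ∀ σ : SmoothSimplex 𝓘(ℝ, E) M 2, ∃ k : ℤ, σ.integral Ω = k + coboundary b σ)
    {x₀ : M} {γ : ℝ → M} (hγ : ContMDiff 𝓘(ℝ, ℝ) 𝓘(ℝ, E) ∞ γ) (hγU : ∀ t, γ t ∈ ballNhd E x₀) :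
    ∃ k : ℤ, ∫ t in (0 : ℝ)..1, potential Ω x₀ (extChartAt 𝓘(ℝ, E) x₀ (γ t))
        (deriv (fun t => extChartAt 𝓘(ℝ, E) x₀ (γ t)) t) =
      k + onCurve b γ - radialValue b x₀ (γ 1) + radialValue b x₀ (γ 0) := by
  set φ := extChartAt 𝓘(ℝ, E) x₀ with hφ
  set c := chartCenter E x₀ with hc
  set g : ℝ → E := fun t => φ (γ t) with hgdef
  have hg : ContDiff ℝ ∞ g :=
    ((contMDiffOn_ballNhd x₀).comp_contMDiff hγ hγU).contDiff
  have hgB : ∀ t, g t ∈ Metric.ball c (chartRadius E x₀) := fun t => (hγU t).2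
  have hsymm : ∀ t, φ.symm (g t) = γ t := fun t => φ.left_inv (hγU t).1
  have hA := contDiffOn_inChart hΩ x₀
  let F : (Fin 3 → ℝ) → M := fun t => φ.symm (cone c g (t 1) (t 2))
  have hF : ContMDiff 𝓘(ℝ, Fin 3 → ℝ) 𝓘(ℝ, E) ∞ F := by
    have h1 : ContDiff ℝ ∞ (fun t : Fin 3 → ℝ => cone c g (t 1) (t 2)) :=
      (contDiff_cone hg).comp (f := fun t : Fin 3 → ℝ => (t 1, t 2)) (by fun_prop)
    exact (contMDiffOn_symm_chartBall x₀).comp_contMDiff h1.contMDiff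
      fun t => cone_mem_ball hgB _ _
  let σ : SmoothSimplex 𝓘(ℝ, E) M 2 := SmoothSimplex.ofMap F hF
  have hface0 : σ.face 0 = SmoothSimplex.ofCurve γ hγ := by
    refine SmoothSimplex.ext' fun t => ?_
    have ht : t.1 0 + t.1 1 = 1 := by simpa [Fin.sum_univ_two] using t.2.2
    change φ.symm (cone c g (t.1 0) (t.1 1)) = γ (t.1 1)
    rw [cone, ht, div_one, cutoff_one, one_smul, add_sub_cancel, hsymm]
  have hface1 : σ.face 1 = SmoothSimplex.ofCurve _ (contMDiff_radialCurve (hγU 1)) := by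
    refine SmoothSimplex.ext' fun t => ?_
    change φ.symm (cone c g 0 (t.1 1)) = radialCurve E x₀ (γ 1) (t.1 1)
    rw [cone, zero_add, radialCurve]
    by_cases h : t.1 1 = 0
    · rw [h, cutoff_zero, zero_smul, zero_smul]
    · rw [div_self h]
  have hface2 : σ.face 2 = SmoothSimplex.ofCurve _ (contMDiff_radialCurve (hγU 0)) := by
    refine SmoothSimplex.ext' fun t => ?_
    change φ.symm (cone c g (t.1 1) 0) = radialCurve E x₀ (γ 0) (t.1 1)
    rw [cone, add_zero, zero_div, radialCurve]
  have hcob : coboundary b σ =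
      onCurve b γ - radialValue b x₀ (γ 1) + radialValue b x₀ (γ 0) := by
    rw [coboundary, Fin.sum_univ_three, hface0, hface1, hface2, onCurve_eq b hγ, radialValue,
      radialValue, onCurve_eq b (contMDiff_radialCurve (hγU 1)),
      onCurve_eq b (contMDiff_radialCurve (hγU 0))]
    simp
    ring
  have hint : σ.integral Ω = ∫ t in (0 : ℝ)..1, potential Ω x₀ (g t) (deriv g t) := by
    have hTopen : IsOpen {t : Fin 2 → ℝ | (∀ i, 0 < t i) ∧ ∑ i, t i < 1} := by
      have h1 : IsOpen {t : Fin 2 → ℝ | ∀ i, 0 < t i} := by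
        simp only [Set.ofPred_forall]
        exact isOpen_iInter_of_finite fun i => isOpen_lt continuous_const (continuous_apply i)
      have h2 : IsOpen {t : Fin 2 → ℝ | ∑ i, t i < 1} :=
        isOpen_lt (continuous_finsetSum _ fun i _ => continuous_apply i) continuous_const
      exact h1.inter h2
    have hparam : ∀ t ∈ {t : Fin 2 → ℝ | (∀ i, 0 < t i) ∧ ∑ i, t i < 1},
        σ.param t = φ.symm (cone c g (t 0) (t 1)) := by
      rintro t ⟨ht0, ht1⟩
      have hmem : (Fin.cons (1 - ∑ i, t i) t : Fin 3 → ℝ) ∈ stdSimplex ℝ (Fin 3) := by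
        refine ⟨fun i => ?_, by simp [Fin.sum_univ_succ]⟩
        refine Fin.cases ?_ (fun j => ?_) i
        · simpa using ht1.le
        · simpa using (ht0 j).le
      rw [SmoothSimplex.param, dif_pos hmem]
      rfl
    let Q : ℝ → ℝ → ℝ := fun r s => cutoff r * deriv cutoff r *
      DiffForm.inChart Ω x₀ (c + cutoff r • (g s - c)) ![g s - c, deriv g s]
    have hQ : Continuous (Function.uncurry Q) := by
      have h1 : Continuous (fun p : ℝ × ℝ => DiffForm.inChart Ω x₀
          (c + cutoff p.1 • (g p.2 - c))) := by
        refine hA.continuousOn.comp_continuous ?_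
          fun p => add_smul_sub_mem_ball (hgB p.2) (cutoff_mem p.1)
        exact continuous_const.add ((contDiff_cutoff.continuous.comp continuous_fst).smul
          ((hg.continuous.comp continuous_snd).sub continuous_const))
      have h2 : Continuous (fun p : ℝ × ℝ => curryTwo (DiffForm.inChart Ω x₀
          (c + cutoff p.1 • (g p.2 - c))) (g p.2 - c) (deriv g p.2)) :=
        ((contDiff_curryTwo.continuous.comp h1).clm_apply
          ((hg.continuous.comp continuous_snd).sub continuous_const)).clm_apply
          ((hg.continuous_deriv (by simp)).comp continuous_snd)
      simp only [curryTwo_apply] at h2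
      exact ((contDiff_cutoff.continuous.comp continuous_fst).mul
        ((contDiff_cutoff.continuous_deriv (by simp)).comp continuous_fst)).mul h2
    rw [SmoothSimplex.integral]
    rw [MeasureTheory.setIntegral_congr_fun (g := fun t : Fin 2 → ℝ => (t 0 + t 1)⁻¹ *
      Q (t 0 + t 1) (t 1 / (t 0 + t 1))) hTopen.measurableSet ?_, setIntegral_triangle hQ]
    · refine intervalIntegral.integral_congr fun s _ => ?_
      change _ = radialPrimitive (DiffForm.inChart Ω x₀) c (g s) (deriv g s)
      rw [radialPrimitive_apply hA (hgB s)]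
      refine Eq.trans ?_ (integral_comp_cutoff (f := fun u => u *
        DiffForm.inChart Ω x₀ (c + u • (g s - c)) ![g s - c, deriv g s]) ?_)
      · refine intervalIntegral.integral_congr fun r _ => ?_
        simp only [Q]
        ring
      · refine continuousOn_id.mul ?_
        have h1 : ContinuousOn (fun u : ℝ => DiffForm.inChart Ω x₀ (c + u • (g s - c)))
            (Set.Icc 0 1) :=
          hA.continuousOn.comp (by fun_prop) fun u hu => add_smul_sub_mem_ball (hgB s) hu
        have h2 : ContinuousOn (fun u : ℝ => curryTwo (DiffForm.inChart Ω x₀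
            (c + u • (g s - c))) (g s - c) (deriv g s)) (Set.Icc 0 1) :=
          ((contDiff_curryTwo.continuous.comp_continuousOn h1).clm_apply
            continuousOn_const).clm_apply continuousOn_const
        simpa only [curryTwo_apply] using h2
    · intro t ht
      have hpos : 0 < t 0 + t 1 := add_pos (ht.1 0) (ht.1 1)
      have hd : DifferentiableAt ℝ (fun t : Fin 2 → ℝ => cone c g (t 0) (t 1)) t :=
        ((contDiff_cone hg).differentiable (by simp) (t 0, t 1)).comp
          (f := fun t : Fin 2 → ℝ => (t 0, t 1)) t (by fun_prop)
      have hev : σ.param =ᶠ[𝓝 t] φ.symm ∘ fun t : Fin 2 → ℝ => cone c g (t 0) (t 1) := by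
        filter_upwards [hTopen.mem_nhds ht] with u hu using hparam u hu
      beta_reduce
      rw [pullback_eq_of_eventuallyEq_symm Ω hev hd (cone_mem_ball hgB _ _),
        form_fderiv_cone _ hg hpos]
      simp only [Q, cone]
  obtain ⟨k, hk⟩ := hb σ
  refine ⟨k, ?_⟩
  rw [← hint, hk, hcob]
  ring

end Potential

section Segments

variable {E : Type*} [NormedAddCommGroup E] [NormedSpace ℝ E] [FiniteDimensional ℝ E]
  {M : Type*} [TopologicalSpace M] [ChartedSpace E M] [IsManifold 𝓘(ℝ, E) ∞ M]
  {V : Type*} [NormedAddCommGroup V] [NormedSpace ℝ V]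
  {Ω : DiffForm 𝓘(ℝ, E) M 2} {b : SmoothSimplex 𝓘(ℝ, E) M 1 → ℝ}

/-- The pullback of the radial potential at `x₀` under a map into `M`. -/
def pulledPotential (Ω : DiffForm 𝓘(ℝ, E) M 2) (x₀ : M) (h : V → M) (p : V) : V →L[ℝ] ℝ :=
  (potential Ω x₀ (extChartAt 𝓘(ℝ, E) x₀ (h p))).comp
    (fderiv ℝ (fun p => extChartAt 𝓘(ℝ, E) x₀ (h p)) p)

/-- The image under `h` of the segment from `x` to `y`, parametrized by the cutoff. -/
def segmentCurve (h : V → M) (x y : V) (t : ℝ) : M := h (x + cutoff t • (y - x))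

omit [FiniteDimensional ℝ E] [IsManifold 𝓘(ℝ, E) ∞ M] in
lemma contMDiff_segmentCurve {h : V → M} {U : Set V} (hh : ContMDiffOn 𝓘(ℝ, V) 𝓘(ℝ, E) ∞ h U)
    {x y : V} (hxy : ∀ t ∈ Set.Icc (0 : ℝ) 1, x + t • (y - x) ∈ U) :
    ContMDiff 𝓘(ℝ, ℝ) 𝓘(ℝ, E) ∞ (segmentCurve h x y) := by
  have h1 : ContDiff ℝ ∞ (fun t => x + cutoff t • (y - x)) :=
    contDiff_const.add (contDiff_cutoff.smul contDiff_const)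
  exact hh.comp_contMDiff h1.contMDiff fun t => hxy _ (cutoff_mem t)

omit [FiniteDimensional ℝ E] in
lemma contDiffOn_chart_comp {x₀ : M} {h : V → M} {U : Set V}
    (hh : ContMDiffOn 𝓘(ℝ, V) 𝓘(ℝ, E) ∞ h U) (hU : Set.MapsTo h U (ballNhd E x₀)) :
    ContDiffOn ℝ ∞ (fun p => extChartAt 𝓘(ℝ, E) x₀ (h p)) U :=
  ((contMDiffOn_ballNhd x₀).comp hh hU).contDiffOn

lemma contDiffOn_pulledPotential (hΩ : DiffForm.SmoothOn Ω Set.univ) {x₀ : M} {h : V → M}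
    {U : Set V} (hUo : IsOpen U) (hh : ContMDiffOn 𝓘(ℝ, V) 𝓘(ℝ, E) ∞ h U)
    (hU : Set.MapsTo h U (ballNhd E x₀)) : ContDiffOn ℝ ∞ (pulledPotential Ω x₀ h) U := by
  have hg := contDiffOn_chart_comp hh hU
  exact ((contDiffOn_potential hΩ x₀).comp hg fun p hp => (hU hp).2).clm_comp
    (hg.fderiv_of_isOpen hUo (by simp))

lemma phase_radialValue_segment (hΩ : DiffForm.SmoothOn Ω Set.univ)
    (hb : ∀ σ : SmoothSimplex 𝓘(ℝ, E) M 2, ∃ k : ℤ, σ.integral Ω = k + coboundary b σ)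
    {x₀ : M} {h : V → M} {U : Set V} (hUo : IsOpen U)
    (hh : ContMDiffOn 𝓘(ℝ, V) 𝓘(ℝ, E) ∞ h U) (hU : Set.MapsTo h U (ballNhd E x₀)) {x y : V}
    (hxy : ∀ t ∈ Set.Icc (0 : ℝ) 1, x + t • (y - x) ∈ U) :
    phase (radialValue b x₀ (h y)) = phase (radialValue b x₀ (h x)) *
      phase (onCurve b (segmentCurve h x y)) *
        phase (-∫ t in (0 : ℝ)..1, pulledPotential Ω x₀ h (x + t • (y - x)) (y - x)) := by
  have hγ := contMDiff_segmentCurve hh hxy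
  obtain ⟨k, hk⟩ := integral_potential_curve hΩ hb hγ
    (fun t => hU (hxy _ (cutoff_mem t)))
  have hg := contDiffOn_chart_comp hh hU
  have hκ := contDiffOn_pulledPotential hΩ hUo hh hU
  have hint : ∫ t in (0 : ℝ)..1, pulledPotential Ω x₀ h (x + t • (y - x)) (y - x) =
      ∫ t in (0 : ℝ)..1, potential Ω x₀ (extChartAt 𝓘(ℝ, E) x₀ (segmentCurve h x y t))
        (deriv (fun t => extChartAt 𝓘(ℝ, E) x₀ (segmentCurve h x y t)) t) := by
    refine (integral_comp_cutoff (f := fun t =>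
      pulledPotential Ω x₀ h (x + t • (y - x)) (y - x)) ?_).symm.trans ?_
    · exact (hκ.continuousOn.comp (by fun_prop) hxy).clm_apply continuousOn_const
    · refine intervalIntegral.integral_congr fun t _ => ?_
      have hd : HasFDerivAt (fun p => extChartAt 𝓘(ℝ, E) x₀ (h p))
          (fderiv ℝ (fun p => extChartAt 𝓘(ℝ, E) x₀ (h p)) (x + cutoff t • (y - x)))
          (x + cutoff t • (y - x)) :=
        ((hg.contDiffAt (hUo.mem_nhds (hxy _ (cutoff_mem t)))).differentiableAt
          (by simp)).hasFDerivAt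
      have hc : HasDerivAt (fun t => x + cutoff t • (y - x)) (deriv cutoff t • (y - x)) t :=
        ((contDiff_cutoff.differentiable (by simp) t).hasDerivAt.smul_const (y - x)).const_add x
      have hderiv := (HasFDerivAt.comp_hasDerivAt t hd hc).deriv
      simp only [segmentCurve, Function.comp_def] at hderiv ⊢
      rw [hderiv, pulledPotential, ContinuousLinearMap.comp_apply, map_smul, map_smul, smul_eq_mul,
        mul_comm]
  rw [hint, hk, ← phase_add, ← phase_add, ← phase_add_intCast _ (-k)]
  congr 1
  simp only [segmentCurve, cutoff_one, cutoff_zero, one_smul, zero_smul, add_sub_cancel, add_zero,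
    Int.cast_neg]
  ring

lemma phase_radialValue_sub_segment (hΩ : DiffForm.SmoothOn Ω Set.univ)
    (hb : ∀ σ : SmoothSimplex 𝓘(ℝ, E) M 2, ∃ k : ℤ, σ.integral Ω = k + coboundary b σ)
    {i j : M} {h : V → M} {U : Set V} (hUo : IsOpen U)
    (hh : ContMDiffOn 𝓘(ℝ, V) 𝓘(ℝ, E) ∞ h U) (hi : Set.MapsTo h U (ballNhd E i))
    (hj : Set.MapsTo h U (ballNhd E j)) (x y : V)
    (hxy : ∀ t ∈ Set.Icc (0 : ℝ) 1, x + t • (y - x) ∈ U) :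
    phase (radialValue b j (h y) - radialValue b i (h y)) =
      phase (radialValue b j (h x) - radialValue b i (h x)) *
        phase (∫ t in (0 : ℝ)..1, (pulledPotential Ω i h (x + t • (y - x)) -
          pulledPotential Ω j h (x + t • (y - x))) (y - x)) := by
  have e := phase_radialValue_segment hΩ hb hUo hh hi hxy
  have e' := phase_radialValue_segment hΩ hb hUo hh hj hxy
  have hc : ∀ k : M, Set.MapsTo h U (ballNhd E k) → IntervalIntegrable
      (fun t : ℝ => pulledPotential Ω k h (x + t • (y - x)) (y - x)) MeasureTheory.volume 0 1 := by
    intro k hk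
    refine ContinuousOn.intervalIntegrable ?_
    rw [Set.uIcc_of_le zero_le_one]
    exact ((contDiffOn_pulledPotential hΩ hUo hh hk).continuousOn.comp (by fun_prop) hxy).clm_apply
      continuousOn_const
  simp only [sub_apply]
  rw [intervalIntegral.integral_sub (hc i hi) (hc j hj)]
  have hsub : ∀ s t : ℝ, phase (s - t) = phase s * (phase t)⁻¹ := fun s t => by
    rw [eq_mul_inv_iff_mul_eq₀ (phase_ne_zero t), ← phase_add, sub_add_cancel]
  have hneg : ∀ s : ℝ, phase (-s) = (phase s)⁻¹ := fun s => by
    rw [← zero_sub, hsub, phase_zero, one_mul]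
  have n1 := phase_ne_zero (onCurve b (segmentCurve h x y))
  have n2 := fun t => phase_ne_zero t
  rw [hsub, hsub, hsub, e, e', hneg, hneg]
  field_simp [n2]

variable [FiniteDimensional ℝ V]

/-- The derivative, in any smooth parametrization, of the transition function between the
trivializations centred at `i` and `j`. -/
lemma hasFDerivAt_transition (hΩ : DiffForm.SmoothOn Ω Set.univ)
    (hb : ∀ σ : SmoothSimplex 𝓘(ℝ, E) M 2, ∃ k : ℤ, σ.integral Ω = k + coboundary b σ)
    {i j : M} {h : V → M} {U : Set V} (hUo : IsOpen U)
    (hh : ContMDiffOn 𝓘(ℝ, V) 𝓘(ℝ, E) ∞ h U) (hi : Set.MapsTo h U (ballNhd E i))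
    (hj : Set.MapsTo h U (ballNhd E j)) {x : V} (hx : x ∈ U) :
    HasFDerivAt (fun p => phase (radialValue b j (h p) - radialValue b i (h p)))
      ((2 * Real.pi * Complex.I * phase (radialValue b j (h x) - radialValue b i (h x))) •
        Complex.ofRealCLM.comp (pulledPotential Ω i h x - pulledPotential Ω j h x)) x :=
  hasFDerivAt_of_phase_integral (κ := fun p => pulledPotential Ω i h p - pulledPotential Ω j h p)
    hUo ((contDiffOn_pulledPotential hΩ hUo hh hi).sub (contDiffOn_pulledPotential hΩ hUo hh hj))
    (phase_radialValue_sub_segment hΩ hb hUo hh hi hj) hx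

lemma contDiffOn_transition (hΩ : DiffForm.SmoothOn Ω Set.univ)
    (hb : ∀ σ : SmoothSimplex 𝓘(ℝ, E) M 2, ∃ k : ℤ, σ.integral Ω = k + coboundary b σ)
    {i j : M} {h : V → M} {U : Set V} (hUo : IsOpen U)
    (hh : ContMDiffOn 𝓘(ℝ, V) 𝓘(ℝ, E) ∞ h U) (hi : Set.MapsTo h U (ballNhd E i))
    (hj : Set.MapsTo h U (ballNhd E j)) :
    ContDiffOn ℝ ∞ (fun p => phase (radialValue b j (h p) - radialValue b i (h p))) U :=
  contDiffOn_of_phase_integral (κ := fun p => pulledPotential Ω i h p - pulledPotential Ω j h p)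
    hUo ((contDiffOn_pulledPotential hΩ hUo hh hi).sub (contDiffOn_pulledPotential hΩ hUo hh hj))
    (phase_radialValue_sub_segment hΩ hb hUo hh hi hj)

omit [FiniteDimensional ℝ E] in
lemma isOpen_chart_overlap (i : M) {S : Set M} (hS : IsOpen S) :
    IsOpen (chartBall E i ∩ (extChartAt 𝓘(ℝ, E) i).symm ⁻¹' S) :=
  (contMDiffOn_symm_chartBall i).continuousOn.isOpen_inter_preimage (isOpen_chartBall E i) hS

lemma contMDiffOn_transition (hΩ : DiffForm.SmoothOn Ω Set.univ)
    (hb : ∀ σ : SmoothSimplex 𝓘(ℝ, E) M 2, ∃ k : ℤ, σ.integral Ω = k + coboundary b σ)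
    (i j : M) :
    ContMDiffOn 𝓘(ℝ, E) 𝓘(ℝ, ℂ) ∞ (fun x => phase (radialValue b j x - radialValue b i x))
      (ballNhd E i ∩ ballNhd E j) := by
  have h1 := contDiffOn_transition hΩ hb (i := i) (j := j)
    (h := (extChartAt 𝓘(ℝ, E) i).symm)
    (isOpen_chart_overlap i (isOpen_ballNhd E j))
    ((contMDiffOn_symm_chartBall i).mono Set.inter_subset_left)
    (fun p hp => symm_mem_ballNhd hp.1) (fun p hp => hp.2)
  have h2 : Set.MapsTo (extChartAt 𝓘(ℝ, E) i) (ballNhd E i ∩ ballNhd E j)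
      (chartBall E i ∩ (extChartAt 𝓘(ℝ, E) i).symm ⁻¹' ballNhd E j) := fun x hx =>
    ⟨hx.1.2, by
      rw [Set.mem_preimage, (extChartAt 𝓘(ℝ, E) i).left_inv hx.1.1]
      exact hx.2⟩
  refine (h1.contMDiffOn.comp ((contMDiffOn_ballNhd i).mono Set.inter_subset_left) h2).congr ?_
  intro x hx
  simp only [Function.comp_apply, (extChartAt 𝓘(ℝ, E) i).left_inv hx.1.1]

end Segments

section PhaseBundle

variable (E : Type*) [NormedAddCommGroup E] [NormedSpace ℝ E]
  (M : Type*) [TopologicalSpace M] [ChartedSpace E M]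

/-- An open cover of `M` indexed by its points, with functions `f i` whose differences have smooth
phases on the overlaps. -/
structure PhaseData where
  U : M → Set M
  f : M → M → ℝ
  isOpen : ∀ i, IsOpen (U i)
  mem : ∀ i, i ∈ U i
  smooth : ∀ i j, ContMDiffOn 𝓘(ℝ, E) 𝓘(ℝ, ℂ) ∞ (fun x => phase (f j x - f i x)) (U i ∩ U j)

variable {E M} (D : PhaseData E M)

/-- The complex line bundle with transition functions the phases of the differences `f j - f i`. -/
def PhaseData.core : VectorBundleCore ℂ M ℂ M where
  baseSet := D.U
  isOpen_baseSet := D.isOpen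
  indexAt x := x
  mem_baseSet_at := D.mem
  coordChange i j x := ContinuousLinearMap.mul ℂ ℂ (phase (D.f j x - D.f i x))
  coordChange_self i _ _ v := by simp
  continuousOn_coordChange i j :=
    (ContinuousLinearMap.mul ℂ ℂ).continuous.comp_continuousOn (D.smooth i j).continuousOn
  coordChange_comp i j k _ _ v := by
    simp only [ContinuousLinearMap.mul_apply']
    rw [← mul_assoc, ← phase_add]
    ring_nf

lemma PhaseData.coordChangeL_real (i j : M) [(D.core.localTriv i).IsLinear ℝ]
    [(D.core.localTriv j).IsLinear ℝ] {x : M} (hx : x ∈ D.U i ∩ D.U j) :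
    ((D.core.localTriv i).coordChangeL ℝ (D.core.localTriv j) x : ℂ →L[ℝ] ℂ) =
      ContinuousLinearMap.mul ℝ ℂ (phase (D.f j x - D.f i x)) := by
  ext1 v
  have h := Trivialization.coordChangeL_apply' (R := ℝ) (D.core.localTriv i) (D.core.localTriv j)
    (b := x) hx v
  refine h.trans ?_
  have h' := Trivialization.coordChangeL_apply' (R := ℂ) (D.core.localTriv i) (D.core.localTriv j)
    (b := x) hx v
  exact h'.symm.trans (D.core.localTriv_coordChange_eq i j hx v)

lemma PhaseData.isLinear_real (i : M) : (D.core.localTriv i).IsLinear ℝ where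
  linear _ hx :=
    { map_add := ((D.core.localTriv i).linear ℂ hx).map_add
      map_smul := fun c v => ((D.core.localTriv i).linear ℂ hx).map_smul (c : ℂ) v }

instance PhaseData.vectorBundle_real : VectorBundle ℝ ℂ D.core.Fiber where
  trivialization_linear' := by
    rintro _ ⟨i, rfl⟩
    exact D.isLinear_real i
  continuousOn_coordChange' := by
    rintro _ _ ⟨i, rfl⟩ ⟨j, rfl⟩
    have := D.isLinear_real i
    have := D.isLinear_real j
    exact ((ContinuousLinearMap.mul ℝ ℂ).continuous.comp_continuousOn
      (D.smooth i j).continuousOn).congr fun _ hx => D.coordChangeL_real i j hx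

instance PhaseData.contMDiffVectorBundle :
    ContMDiffVectorBundle ∞ ℂ D.core.Fiber 𝓘(ℝ, E) where
  contMDiffOn_coordChangeL := by
    rintro _ _ ⟨i, rfl⟩ ⟨j, rfl⟩
    have := D.isLinear_real i
    have := D.isLinear_real j
    exact ((ContinuousLinearMap.mul ℝ ℂ).contDiff.contMDiff.comp_contMDiffOn
      (D.smooth i j)).congr fun _ hx => D.coordChangeL_real i j hx

/-- The complex line bundle attached to phase data. -/
def PhaseData.bundle : ComplexLineBundle E M where
  Fiber := D.core.Fiber

end PhaseBundle

section Angular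

/-- The real linear functional `ζ ↦ Im(ζ / w) / 2π`. -/
def angular (w : ℂ) : ℂ →L[ℝ] ℝ :=
  (1 / (2 * Real.pi)) • Complex.imCLM.comp (ContinuousLinearMap.mul ℝ ℂ w⁻¹)

lemma angular_apply (w ζ : ℂ) : angular w ζ = (1 / (2 * Real.pi)) * (w⁻¹ * ζ).im := by
  simp [angular]

lemma angular_mul_mul {z : ℂ} (hz : z ≠ 0) (w ζ : ℂ) : angular (z * w) (z * ζ) = angular w ζ := by
  rw [angular_apply, angular_apply, mul_inv]
  congr 2
  field_simp

lemma angular_mul_self {w : ℂ} (hw : w ≠ 0) (ζ : ℂ) :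
    angular w (ζ * w) = (1 / (2 * Real.pi)) * ζ.im := by
  rw [angular_apply, mul_comm ζ, inv_mul_cancel_left₀ hw]

lemma hasFDerivAt_angular {w : ℂ} (hw : w ≠ 0) :
    HasFDerivAt angular (((1 / (2 * Real.pi)) • (ContinuousLinearMap.compL ℝ ℂ ℂ ℝ Complex.imCLM)).comp
      ((ContinuousLinearMap.mul ℝ ℂ).comp
        (-(ContinuousLinearMap.mul ℝ ℂ ((w ^ 2)⁻¹))))) w := by
  have h1 : HasFDerivAt (fun w : ℂ => w⁻¹) (-(ContinuousLinearMap.mul ℝ ℂ ((w ^ 2)⁻¹))) w := by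
    refine ((hasDerivAt_inv hw).hasFDerivAt.restrictScalars ℝ).congr_fderiv ?_
    ext
    simp [mul_comm]
  have h2 := (ContinuousLinearMap.mul ℝ ℂ).hasFDerivAt.comp w h1
  exact ((1 / (2 * Real.pi)) •
    (ContinuousLinearMap.compL ℝ ℂ ℂ ℝ Complex.imCLM)).hasFDerivAt.comp w h2

lemma fderiv_angular_symm {w : ℂ} (hw : w ≠ 0) (ζ ζ' : ℂ) :
    fderiv ℝ angular w ζ ζ' = fderiv ℝ angular w ζ' ζ := by
  rw [(hasFDerivAt_angular hw).fderiv]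
  simp
  ring_nf

lemma contDiffOn_angular : ContDiffOn ℝ ∞ angular {w | w ≠ 0} := by
  have h1 : ContDiffOn ℝ ∞ (fun w : ℂ => w⁻¹) {w | w ≠ 0} := contDiffOn_inv ℝ
  have h2 := ((1 / (2 * Real.pi)) • (ContinuousLinearMap.compL ℝ ℂ ℂ ℝ Complex.imCLM)).contDiff
    (n := ∞) |>.comp_contDiffOn ((ContinuousLinearMap.mul ℝ ℂ).contDiff.comp_contDiffOn h1)
  exact h2

end Angular

section TotalSpaceCharts

variable {E : Type*} [NormedAddCommGroup E] [NormedSpace ℝ E]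
  {M : Type*} [TopologicalSpace M] [ChartedSpace E M] (D : PhaseData E M)

/-- The coordinate of a point of the total space in the trivialization centred at its base point. -/
def PhaseData.fiberCoord (u : D.bundle.Total) : ℂ := u.2

/-- The fibre coordinate in the trivialization centred at `i`. -/
def PhaseData.coord (i : M) (u : D.bundle.Total) : ℂ :=
  phase (D.f i u.proj - D.f u.proj u.proj) * D.fiberCoord u

variable {D}

lemma PhaseData.coord_self (u : D.bundle.Total) : D.coord u.proj u = D.fiberCoord u := by
  simp [PhaseData.coord]

lemma PhaseData.extChartAt_apply (u₀ u : D.bundle.Total) :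
    extChartAt (totalModel E) u₀ u =
      (extChartAt 𝓘(ℝ, E) u₀.proj u.proj, D.coord u₀.proj u) := by
  rw [FiberBundle.extChartAt]
  rfl

lemma PhaseData.extChartAt_symm_apply (u₀ : D.bundle.Total) (q : E × ℂ) :
    (extChartAt (totalModel E) u₀).symm q =
      (⟨(extChartAt 𝓘(ℝ, E) u₀.proj).symm q.1,
        phase (D.f ((extChartAt 𝓘(ℝ, E) u₀.proj).symm q.1)
            ((extChartAt 𝓘(ℝ, E) u₀.proj).symm q.1) -
          D.f u₀.proj ((extChartAt 𝓘(ℝ, E) u₀.proj).symm q.1)) * q.2⟩ : D.bundle.Total) := by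
  rw [FiberBundle.extChartAt]
  rfl

lemma PhaseData.coord_symm (i : M) (u₀ : D.bundle.Total) (q : E × ℂ) :
    D.coord i ((extChartAt (totalModel E) u₀).symm q) =
      phase (D.f i ((extChartAt 𝓘(ℝ, E) u₀.proj).symm q.1) -
        D.f u₀.proj ((extChartAt 𝓘(ℝ, E) u₀.proj).symm q.1)) * q.2 := by
  rw [PhaseData.extChartAt_symm_apply]
  change phase _ * (phase _ * q.2) = _
  rw [← mul_assoc, ← phase_add]
  ring_nf

lemma PhaseData.extChartAt_target (u₀ : D.bundle.Total) :
    (extChartAt (totalModel E) u₀).target =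
      ((extChartAt 𝓘(ℝ, E) u₀.proj).target ∩
        (extChartAt 𝓘(ℝ, E) u₀.proj).symm ⁻¹' D.U u₀.proj) ×ˢ Set.univ := by
  rw [FiberBundle.extChartAt_target]
  rfl

variable [IsManifold 𝓘(ℝ, E) ∞ M]

instance (B : ComplexLineBundle E M) : IsManifold (totalModel E) ∞ B.Total :=
  Bundle.TotalSpace.isManifold ℂ B.Fiber

variable {E' : Type*} [NormedAddCommGroup E'] [NormedSpace ℝ E']
  {H' : Type*} [TopologicalSpace H'] {J : ModelWithCorners ℝ E' H'}
  {N : Type*} [TopologicalSpace N] [ChartedSpace H' N]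

lemma PhaseData.mdifferentiableAt_coord (u : D.bundle.Total) :
    MDifferentiableAt (totalModel E) 𝓘(ℝ, ℂ) (D.coord u.proj) u := by
  have h1 : MDifferentiableAt (totalModel E) 𝓘(ℝ, E × ℂ) (extChartAt (totalModel E) u) u :=
    mdifferentiableAt_extChartAt (mem_chart_source _ u)
  have h2 : MDifferentiableAt 𝓘(ℝ, E × ℂ) 𝓘(ℝ, ℂ) (Prod.snd : E × ℂ → ℂ)
      (extChartAt (totalModel E) u u) := differentiableAt_snd.mdifferentiableAt
  refine (h2.comp u h1).congr_of_eventuallyEq (Filter.Eventually.of_forall fun u' => ?_)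
  exact (congrArg Prod.snd (PhaseData.extChartAt_apply u u')).symm

lemma PhaseData.mfderiv_coord (u : D.bundle.Total) (v : TangentSpace (totalModel E) u) :
    mfderiv (totalModel E) 𝓘(ℝ, ℂ) (D.coord u.proj) u v = (show E × ℂ from v).2 := by
  have h1 : MDifferentiableAt (totalModel E) 𝓘(ℝ, E × ℂ) (extChartAt (totalModel E) u) u :=
    mdifferentiableAt_extChartAt (mem_chart_source _ u)
  have h2 : MDifferentiableAt 𝓘(ℝ, E × ℂ) 𝓘(ℝ, ℂ) (Prod.snd : E × ℂ → ℂ)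
      (extChartAt (totalModel E) u u) := differentiableAt_snd.mdifferentiableAt
  have h3 : D.coord u.proj = Prod.snd ∘ extChartAt (totalModel E) u := by
    funext u'; exact (congrArg Prod.snd (PhaseData.extChartAt_apply u u')).symm
  rw [h3, mfderiv_comp u h2 h1, mfderiv_extChartAt_self, mfderiv_eq_fderiv, fderiv_snd]
  rfl

lemma mfderiv_proj (B : ComplexLineBundle E M) (u : B.Total) (v : TangentSpace (totalModel E) u) :
    mfderiv (totalModel E) 𝓘(ℝ, E) (TotalSpace.proj : B.Total → M) u v = (show E × ℂ from v).1 := by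
  have h1 : MDifferentiableAt (totalModel E) 𝓘(ℝ, E × ℂ) (extChartAt (totalModel E) u) u :=
    mdifferentiableAt_extChartAt (mem_chart_source _ u)
  have h2 : MDifferentiableAt 𝓘(ℝ, E × ℂ) 𝓘(ℝ, E) (Prod.fst : E × ℂ → E)
      (extChartAt (totalModel E) u u) := differentiableAt_fst.mdifferentiableAt
  have h4 : MDifferentiableAt (totalModel E) 𝓘(ℝ, E) (TotalSpace.proj : B.Total → M) u :=
    (contMDiffAt_proj B.Fiber (n := ∞)).mdifferentiableAt (by simp)
  have h5 : MDifferentiableAt 𝓘(ℝ, E) 𝓘(ℝ, E) (extChartAt 𝓘(ℝ, E) u.proj) u.proj :=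
    mdifferentiableAt_extChartAt (mem_chart_source _ u.proj)
  have h3 : extChartAt 𝓘(ℝ, E) u.proj ∘ TotalSpace.proj =ᶠ[𝓝 u]
      Prod.fst ∘ extChartAt (totalModel E) u := by
    filter_upwards [extChartAt_source_mem_nhds (I := totalModel E) u] with u' hu'
    rw [FiberBundle.extChartAt] at hu' ⊢
    have hs : u' ∈ (trivializationAt ℂ B.Fiber u.proj).source := hu'.1
    simp only [Function.comp_apply, PartialEquiv.coe_trans, PartialEquiv.prod_coe]
    congr 1
    exact ((trivializationAt ℂ B.Fiber u.proj).coe_fst hs).symm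
  have e1 := h3.mfderiv_eq (I := totalModel E) (I' := 𝓘(ℝ, E))
  rw [mfderiv_comp u h5 h4, mfderiv_comp u h2 h1, mfderiv_extChartAt_self, mfderiv_extChartAt_self,
    mfderiv_eq_fderiv, fderiv_fst] at e1
  exact congrArg (fun L : E × ℂ →L[ℝ] E => L v) e1

/-- The vertical part of the differential of a map into the total space. -/
lemma PhaseData.mfderiv_snd {f : N → D.bundle.Total} {x : N}
    (hf : MDifferentiableAt J (totalModel E) f x) (v : TangentSpace J x) :
    (show E × ℂ from mfderiv J (totalModel E) f x v).2 =
      mfderiv J 𝓘(ℝ, ℂ) (fun y => D.coord (f x).proj (f y)) x v := by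
  rw [← PhaseData.mfderiv_coord]
  have h := mfderiv_comp x (PhaseData.mdifferentiableAt_coord (f x)) hf
  exact (congrArg (fun L : E' →L[ℝ] ℂ => L v) h).symm

variable (D) in
/-- The connection form which is `Im(dw / w) / 2π` at the centre of each trivialization. -/
def PhaseData.form : DiffForm (totalModel E) D.bundle.Total 1 := fun u =>
  (ContinuousAlternatingMap.ofSubsingletonLIE (𝕜 := ℝ) (E := E × ℂ) (F := ℝ) (0 : Fin 1))
    ((angular (D.fiberCoord u)).comp (ContinuousLinearMap.snd ℝ E ℂ))

omit [IsManifold 𝓘(ℝ, E) ∞ M] in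
lemma PhaseData.form_apply (u : D.bundle.Total) (v : Fin 1 → TangentSpace (totalModel E) u) :
    D.form u v = angular (D.fiberCoord u) (show E × ℂ from v 0).2 := rfl

lemma PhaseData.form_mfderiv {f : N → D.bundle.Total} {x : N}
    (hf : MDifferentiableAt J (totalModel E) f x) (v : TangentSpace J x) :
    D.form (f x) ![mfderiv J (totalModel E) f x v] = angular (D.fiberCoord (f x))
      (mfderiv J 𝓘(ℝ, ℂ) (fun y => D.coord (f x).proj (f y)) x v) := by
  rw [← PhaseData.mfderiv_snd hf, PhaseData.form_apply]
  rfl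

omit [IsManifold 𝓘(ℝ, E) ∞ M] in
lemma PhaseData.contMDiff_mul (z : ℂ) :
    ContMDiff (totalModel E) (totalModel E) ∞ (D.bundle.mul z) := by
  intro u
  refine contMDiffAt_totalSpace.2 ⟨contMDiffAt_proj _, ?_⟩
  have h := (contMDiffAt_totalSpace.1 (contMDiffAt_id (x := u) (I := totalModel E) (n := ∞))).2
  have h2 : ContMDiffAt (totalModel E) 𝓘(ℝ, ℂ) ∞ (fun u' => z * D.coord u.proj u') u :=
    (contDiff_const.mul contDiff_id : ContDiff ℝ ∞ fun w : ℂ => z * w).contMDiff.contMDiffAt.comp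
      u h
  refine h2.congr_of_eventuallyEq (Filter.Eventually.of_forall fun u' => ?_)
  change phase (D.f u.proj u'.proj - D.f u'.proj u'.proj) * (z * D.fiberCoord u') =
      z * (phase (D.f u.proj u'.proj - D.f u'.proj u'.proj) * D.fiberCoord u')
  ring

omit [IsManifold 𝓘(ℝ, E) ∞ M] in
lemma PhaseData.contMDiff_expMul (ζ : ℂ) (u : D.bundle.Total) :
    ContMDiff 𝓘(ℝ, ℝ) (totalModel E) ∞ (fun s : ℝ => D.bundle.mul (Complex.exp (s * ζ)) u) := by
  intro s
  refine contMDiffAt_totalSpace.2 ⟨contMDiffAt_const, ?_⟩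
  have h : ContDiff ℝ ∞ (fun s : ℝ => phase (D.f u.proj u.proj - D.f u.proj u.proj) *
      (Complex.exp (s * ζ) * D.fiberCoord u)) :=
    contDiff_const.mul (((Complex.ofRealCLM.contDiff.mul contDiff_const).cexp).mul contDiff_const)
  exact h.contMDiff.contMDiffAt

lemma PhaseData.form_vertical (ζ : ℂ) {u : D.bundle.Total} (hu : u ∈ D.bundle.nonzero) :
    D.form _ ![D.bundle.vertical ζ u] = 1 / (2 * Real.pi) * ζ.im := by
  have hu' : D.fiberCoord u ≠ 0 := hu
  have h := PhaseData.form_mfderiv (D := D) (((PhaseData.contMDiff_expMul ζ u) 0).mdifferentiableAt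
    (by simp)) (1 : ℝ)
  refine h.trans ?_
  have hc : ∀ s : ℝ, D.coord u.proj (D.bundle.mul (Complex.exp (s * ζ)) u) =
      Complex.exp (s * ζ) * D.fiberCoord u := by
    intro s
    change phase (D.f u.proj u.proj - D.f u.proj u.proj) * (Complex.exp (s * ζ) * D.fiberCoord u) = _
    simp
  have hd : HasDerivAt (fun s : ℝ => Complex.exp (s * ζ) * D.fiberCoord u)
      (ζ * D.fiberCoord u) 0 := by
    have h1 : HasDerivAt (fun s : ℝ => (s : ℂ) * ζ) (1 * ζ) 0 :=
      (Complex.ofRealCLM.hasDerivAt (x := 0)).mul_const ζ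
    simpa using h1.cexp.mul_const (D.fiberCoord u)
  have hm : mfderiv 𝓘(ℝ, ℝ) 𝓘(ℝ, ℂ) (fun s : ℝ => D.coord u.proj
      (D.bundle.mul (Complex.exp (s * ζ)) u)) 0 (1 : ℝ) = ζ * D.fiberCoord u := by
    refine (congrArg (fun g : ℝ → ℂ => (mfderiv 𝓘(ℝ, ℝ) 𝓘(ℝ, ℂ) g 0 : ℝ →L[ℝ] ℂ) 1)
      (funext hc)).trans ?_
    rw [mfderiv_eq_fderiv]
    exact hd.deriv
  have h0 : D.fiberCoord (D.bundle.mul (Complex.exp ((0 : ℝ) * ζ)) u) = D.fiberCoord u := by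
    change Complex.exp ((0 : ℝ) * ζ) * D.fiberCoord u = _
    simp
  refine (congrArg₂ (fun w X => angular w X) h0 hm).trans ?_
  exact angular_mul_self hu' ζ

lemma PhaseData.form_invariant {z : ℂ} (hz : z ≠ 0) (u : D.bundle.Total) :
    DiffForm.pullback (D.bundle.mul z) D.form u = D.form u := by
  ext v
  have hm := ((PhaseData.contMDiff_mul (D := D) z) u).mdifferentiableAt (by simp)
  have h := PhaseData.form_mfderiv (D := D) hm (v 0)
  have hv : DiffForm.pullback (D.bundle.mul z) D.form u v = D.form (D.bundle.mul z u)
      ![mfderiv (totalModel E) (totalModel E) (D.bundle.mul z) u (v 0)] := rfl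
  rw [hv, h]
  have hc : (fun u' => D.coord (D.bundle.mul z u).proj (D.bundle.mul z u')) =
      fun u' => z * D.coord u.proj u' := by
    funext u'
    change phase (D.f u.proj u'.proj - D.f u'.proj u'.proj) * (z * D.fiberCoord u') =
      z * (phase (D.f u.proj u'.proj - D.f u'.proj u'.proj) * D.fiberCoord u')
    ring
  have hd : mfderiv (totalModel E) 𝓘(ℝ, ℂ) (fun u' => z * D.coord u.proj u') u (v 0) =
      z * (show E × ℂ from v 0).2 := by
    have h2 : MDifferentiableAt 𝓘(ℝ, ℂ) 𝓘(ℝ, ℂ) (fun w : ℂ => z * w) (D.coord u.proj u) :=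
      (differentiableAt_id.const_mul z).mdifferentiableAt
    have h3 := mfderiv_comp u h2 (PhaseData.mdifferentiableAt_coord u)
    rw [← PhaseData.mfderiv_coord]
    refine (congrArg (fun L : E × ℂ →L[ℝ] ℂ => L (v 0)) h3).trans ?_
    have h4 : HasFDerivAt (fun w : ℂ => z * w) (ContinuousLinearMap.mul ℝ ℂ z)
      (D.coord u.proj u) := (ContinuousLinearMap.mul ℝ ℂ z).hasFDerivAt
    rw [mfderiv_eq_fderiv, h4.fderiv]
    rfl
  rw [hc]
  refine (congrArg (angular _) hd).trans ?_
  exact angular_mul_mul hz _ _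

end TotalSpaceCharts

section PrequantumForm

variable {E : Type*} [NormedAddCommGroup E] [NormedSpace ℝ E]
  {M : Type*} [TopologicalSpace M] [ChartedSpace E M] [IsManifold 𝓘(ℝ, E) ∞ M]

lemma inChart_self {n : ℕ} (Ω : DiffForm 𝓘(ℝ, E) M n) (x : M) (v : Fin n → E) :
    DiffForm.inChart Ω x (chartCenter E x) v = Ω x v := by
  have h1 : MDifferentiableAt 𝓘(ℝ, E) 𝓘(ℝ, E) (extChartAt 𝓘(ℝ, E) x) x :=
    mdifferentiableAt_extChartAt (mem_chart_source _ x)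
  have h2 : MDifferentiableAt 𝓘(ℝ, E) 𝓘(ℝ, E) (extChartAt 𝓘(ℝ, E) x).symm
      (extChartAt 𝓘(ℝ, E) x x) :=
    ((contMDiffOn_symm_chartBall x).contMDiffAt
      ((isOpen_chartBall E x).mem_nhds (chartCenter_mem E x))).mdifferentiableAt (by simp)
  have h3 : (extChartAt 𝓘(ℝ, E) x).symm ∘ extChartAt 𝓘(ℝ, E) x =ᶠ[𝓝 x] id := by
    filter_upwards [extChartAt_source_mem_nhds (I := 𝓘(ℝ, E)) x] with y hy
    exact (extChartAt 𝓘(ℝ, E) x).left_inv hy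
  have e1 := pullback_comp Ω h2 h1
  have e2 := pullback_congr (I' := 𝓘(ℝ, E)) Ω h3
  have e3 : DiffForm.pullback (I := 𝓘(ℝ, E)) (I' := 𝓘(ℝ, E)) (id : M → M) Ω x v = Ω x v := by
    refine congrArg (Ω x) ?_
    funext k
    exact congrArg (fun L : E →L[ℝ] E => L (v k)) (mfderiv_id (I := 𝓘(ℝ, E)) (x := x))
  have e4 : DiffForm.pullback (I := 𝓘(ℝ, E)) (M := E) (I' := 𝓘(ℝ, E)) (extChartAt 𝓘(ℝ, E) x)
      (DiffForm.inChart Ω x) x v = DiffForm.inChart Ω x (chartCenter E x) v := by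
    simp only [DiffForm.pullback, mfderiv_extChartAt_self]
    rfl
  rw [← e4, ← e3, ← e2, e1]
  rfl

variable [FiniteDimensional ℝ E]
  {Ω : DiffForm 𝓘(ℝ, E) M 2} {b : SmoothSimplex 𝓘(ℝ, E) M 1 → ℝ}

/-- The phase data of a 1-cochain whose coboundary represents the periods of `Ω` modulo
integers. -/
def prequantumData (hΩ : DiffForm.SmoothOn Ω Set.univ)
    (hb : ∀ σ : SmoothSimplex 𝓘(ℝ, E) M 2, ∃ k : ℤ, σ.integral Ω = k + coboundary b σ) :
    PhaseData E M where
  U := ballNhd E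
  f := radialValue b
  isOpen := isOpen_ballNhd E
  mem := mem_ballNhd_self E
  smooth := contMDiffOn_transition hΩ hb

omit [FiniteDimensional ℝ E] [IsManifold 𝓘(ℝ, E) ∞ M] in
lemma pulledPotential_symm {i : M} {p : E} (hp : p ∈ chartBall E i) :
    pulledPotential Ω i (extChartAt 𝓘(ℝ, E) i).symm p = potential Ω i p := by
  have h : (fun p => extChartAt 𝓘(ℝ, E) i ((extChartAt 𝓘(ℝ, E) i).symm p)) =ᶠ[𝓝 p] id := by
    filter_upwards [(isOpen_chartBall E i).mem_nhds hp] with q hq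
    exact (extChartAt 𝓘(ℝ, E) i).right_inv (chartBall_subset E i hq)
  rw [pulledPotential, h.fderiv_eq, fderiv_id, ContinuousLinearMap.comp_id]
  congr 1
  exact h.self_of_nhds

omit [FiniteDimensional ℝ E] [IsManifold 𝓘(ℝ, E) ∞ M] in
lemma pulledPotential_center {V : Type*} [NormedAddCommGroup V] [NormedSpace ℝ V] (h : V → M)
    (p : V) : pulledPotential Ω (h p) h p = 0 := by
  rw [pulledPotential, potential]
  have : radialPrimitive (DiffForm.inChart Ω (h p)) (chartCenter E (h p))
    (extChartAt 𝓘(ℝ, E) (h p) (h p)) = 0 := radialPrimitive_self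
  rw [this, ContinuousLinearMap.zero_comp]

lemma angular_transition {G w : ℂ} (hG : G ≠ 0) (hw : w ≠ 0) (ζ : ℂ) (κ : ℝ) :
    angular (G * w) (G * ζ + (2 * Real.pi * Complex.I * G) * κ * w) = κ + angular w ζ := by
  have e : G * ζ + (2 * Real.pi * Complex.I * G) * κ * w =
      G * (((2 * Real.pi * κ : ℝ) * Complex.I) * w + ζ) := by push_cast; ring
  rw [e, angular_mul_mul hG, map_add, angular_mul_self hw, Complex.im_ofReal_mul, Complex.I_im]
  have := Real.pi_pos
  field_simp

/-- The functional `κ + Im(dw / w) / 2π` on `E × ℂ`. -/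
def formInCoord (κ : E →L[ℝ] ℝ) (w : ℂ) : E × ℂ →L[ℝ] ℝ :=
  κ.comp (ContinuousLinearMap.fst ℝ E ℂ) + (angular w).comp (ContinuousLinearMap.snd ℝ E ℂ)

/-- Continuous linear functionals as alternating 1-forms. -/
abbrev oneFormLIE (V : Type*) [NormedAddCommGroup V] [NormedSpace ℝ V] :
    (V →L[ℝ] ℝ) ≃ₗᵢ[ℝ] V [⋀^Fin 1]→L[ℝ] ℝ :=
  ContinuousAlternatingMap.ofSubsingletonLIE (𝕜 := ℝ) (E := V) (F := ℝ) (0 : Fin 1)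

omit [FiniteDimensional ℝ E] in
lemma PhaseData.inChart_form {D : PhaseData E M} {u₀ : D.bundle.Total} {q : E × ℂ}
    (hq : q ∈ (extChartAt (totalModel E) u₀).target) (hw : q.2 ≠ 0) {x : M}
    (hx : (extChartAt 𝓘(ℝ, E) u₀.proj).symm q.1 = x) {κ : E →L[ℝ] ℝ}
    (hG : HasFDerivAt (fun p => phase (D.f x ((extChartAt 𝓘(ℝ, E) u₀.proj).symm p) -
        D.f u₀.proj ((extChartAt 𝓘(ℝ, E) u₀.proj).symm p)))
      ((2 * Real.pi * Complex.I * phase (D.f x x - D.f u₀.proj x)) • Complex.ofRealCLM.comp κ)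
      q.1) :
    DiffForm.inChart D.form u₀ q = oneFormLIE (E × ℂ) (formInCoord κ q.2) := by
  ext v
  have hsm : MDifferentiableAt 𝓘(ℝ, E × ℂ) (totalModel E) (extChartAt (totalModel E) u₀).symm q :=
    ((contMDiffOn_extChartAt_symm (n := ∞) u₀).contMDiffAt
      ((isOpen_extChartAt_target u₀).mem_nhds hq)).mdifferentiableAt (by simp)
  have hsx : ((extChartAt (totalModel E) u₀).symm q).proj = x := by
    rw [PhaseData.extChartAt_symm_apply, hx]
  refine (PhaseData.form_mfderiv (D := D) hsm (v 0)).trans ?_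
  have hcoord : ∀ y, D.coord ((extChartAt (totalModel E) u₀).symm q).proj
      ((extChartAt (totalModel E) u₀).symm y) =
      phase (D.f x ((extChartAt 𝓘(ℝ, E) u₀.proj).symm y.1) -
        D.f u₀.proj ((extChartAt 𝓘(ℝ, E) u₀.proj).symm y.1)) * y.2 := by
    intro y
    rw [hsx]
    exact PhaseData.coord_symm x u₀ y
  have hfib : D.fiberCoord ((extChartAt (totalModel E) u₀).symm q) =
      phase (D.f x x - D.f u₀.proj x) * q.2 := by
    rw [← PhaseData.coord_self, hcoord, hx]
  have hd := (HasFDerivAt.comp (f := Prod.fst) q hG hasFDerivAt_fst).mul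
    (hasFDerivAt_snd (𝕜 := ℝ) (p := q))
  have hm : mfderiv 𝓘(ℝ, E × ℂ) 𝓘(ℝ, ℂ)
      (fun y => D.coord ((extChartAt (totalModel E) u₀).symm q).proj
        ((extChartAt (totalModel E) u₀).symm y)) q (v 0) =
      (phase (D.f x x - D.f u₀.proj x) * (v 0).2 +
        (2 * Real.pi * Complex.I * phase (D.f x x - D.f u₀.proj x)) * (κ (v 0).1 : ℝ) * q.2 : ℂ) := by
    refine (congrArg (fun g : E × ℂ → ℂ =>
      (mfderiv 𝓘(ℝ, E × ℂ) 𝓘(ℝ, ℂ) g q : E × ℂ →L[ℝ] ℂ) (v 0)) (funext hcoord)).trans ?_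
    rw [mfderiv_eq_fderiv]
    refine (congrArg (fun L : E × ℂ →L[ℝ] ℂ => L (v 0)) hd.fderiv).trans ?_
    simp only [Function.comp_apply, hx, add_apply, smul_apply, smul_eq_mul,
      ContinuousLinearMap.coe_snd', ContinuousLinearMap.comp_apply, ContinuousLinearMap.coe_fst',
      Complex.ofRealCLM_apply]
    ring
  refine (congrArg₂ (fun w X => angular w X) hfib hm).trans ?_
  rw [angular_transition (phase_ne_zero _) hw]
  rfl

omit [FiniteDimensional ℝ E] in
/-- The exterior derivative of the connection form, at a point where it is given nearby by a
potential `A`. -/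
lemma PhaseData.d_form {D : PhaseData E M} {u : D.bundle.Total} (hu : D.fiberCoord u ≠ 0)
    {A : E → E →L[ℝ] ℝ} {A' : E →L[ℝ] E →L[ℝ] ℝ} (hA : HasFDerivAt A A' (chartCenter E u.proj))
    (hD : ∀ q ∈ (extChartAt (totalModel E) u).target, q.2 ≠ 0 →
      DiffForm.inChart D.form u q = oneFormLIE (E × ℂ) (formInCoord (A q.1) q.2))
    (v : Fin 2 → E × ℂ) :
    DiffForm.d D.form u v = A' (v 0).1 (v 1).1 - A' (v 1).1 (v 0).1 := by
  have hc : extChartAt (totalModel E) u u = (chartCenter E u.proj, D.fiberCoord u) := by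
    rw [PhaseData.extChartAt_apply, PhaseData.coord_self]
    rfl
  have hev : DiffForm.inChart D.form u =ᶠ[𝓝 (chartCenter E u.proj, D.fiberCoord u)] fun q =>
      oneFormLIE (E × ℂ) (formInCoord (A q.1) q.2) := by
    have h2 : ∀ᶠ q : E × ℂ in 𝓝 (chartCenter E u.proj, D.fiberCoord u), q.2 ≠ 0 :=
      continuousAt_snd.eventually_ne hu
    have h1 := (isOpen_extChartAt_target u).mem_nhds (mem_extChartAt_target (I := totalModel E) u)
    rw [hc] at h1
    filter_upwards [h1, h2] with q h h'
    exact hD q h h'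
  have hang : HasFDerivAt angular (fderiv ℝ angular (D.fiberCoord u)) (D.fiberCoord u) :=
    (hasFDerivAt_angular hu).differentiableAt.hasFDerivAt
  have hX : ∀ X : E × ℂ, HasFDerivAt (fun q : E × ℂ => A q.1 X.1 + angular q.2 X.2)
      ((A'.flip X.1).comp (ContinuousLinearMap.fst ℝ E ℂ) +
        ((fderiv ℝ angular (D.fiberCoord u)).flip X.2).comp (ContinuousLinearMap.snd ℝ E ℂ))
      (chartCenter E u.proj, D.fiberCoord u) := by
    intro X
    have h1 : HasFDerivAt (fun p => A p X.1) (A'.flip X.1) (chartCenter E u.proj) := by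
      refine (hA.clm_apply (hasFDerivAt_const X.1 _)).congr_fderiv ?_
      ext; simp
    have h2 : HasFDerivAt (fun w => angular w X.2)
        ((fderiv ℝ angular (D.fiberCoord u)).flip X.2) (D.fiberCoord u) := by
      refine (hang.clm_apply (hasFDerivAt_const X.2 _)).congr_fderiv ?_
      ext; simp
    exact (HasFDerivAt.comp (f := Prod.fst) (chartCenter E u.proj, D.fiberCoord u) h1
      hasFDerivAt_fst).add (HasFDerivAt.comp (f := Prod.snd)
        (chartCenter E u.proj, D.fiberCoord u) h2 hasFDerivAt_snd)
  have hdiff : DifferentiableAt ℝ (fun q : E × ℂ => formInCoord (A q.1) q.2)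
      (chartCenter E u.proj, D.fiberCoord u) := by
    refine DifferentiableAt.add ?_ ?_
    · exact (hA.differentiableAt.comp (f := Prod.fst) (chartCenter E u.proj, D.fiberCoord u)
        differentiableAt_fst).clm_comp (differentiableAt_const _)
    · exact (hang.differentiableAt.comp (f := Prod.snd) (chartCenter E u.proj, D.fiberCoord u)
        differentiableAt_snd).clm_comp (differentiableAt_const _)
  have hdiff' : DifferentiableAt ℝ (fun q : E × ℂ => oneFormLIE (E × ℂ) (formInCoord (A q.1) q.2))
      (chartCenter E u.proj, D.fiberCoord u) :=
    (oneFormLIE (E × ℂ)).toContinuousLinearEquiv.differentiableAt.comp _ hdiff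
  have hd : DiffForm.d D.form u v = extDeriv (DiffForm.inChart D.form u)
      (extChartAt (totalModel E) u u) v := by
    simp only [DiffForm.d, mfderiv_extChartAt_self]
    rfl
  rw [hd, hc, hev.extDeriv_eq, extDeriv_apply hdiff', Fin.sum_univ_two]
  have e0 : fderiv ℝ (fun q : E × ℂ => oneFormLIE (E × ℂ) (formInCoord (A q.1) q.2)
      ((0 : Fin 2).removeNth v)) (chartCenter E u.proj, D.fiberCoord u) = _ := (hX (v 1)).fderiv
  have e1 : fderiv ℝ (fun q : E × ℂ => oneFormLIE (E × ℂ) (formInCoord (A q.1) q.2)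
      ((1 : Fin 2).removeNth v)) (chartCenter E u.proj, D.fiberCoord u) = _ := (hX (v 0)).fderiv
  rw [e0, e1]
  have hsymm := fderiv_angular_symm hu (v 0).2 (v 1).2
  simp
  rw [hsymm]
  ring

omit [IsManifold 𝓘(ℝ, E) ∞ M] [FiniteDimensional ℝ E] in
lemma PhaseData.snd_ne_zero_of_symm_mem_nonzero {D : PhaseData E M} {u₀ : D.bundle.Total}
    {q : E × ℂ} (hq : (extChartAt (totalModel E) u₀).symm q ∈ D.bundle.nonzero) : q.2 ≠ 0 := by
  rintro h
  apply hq
  rw [PhaseData.extChartAt_symm_apply]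
  change _ * q.2 = 0
  rw [h, mul_zero]

omit [IsManifold 𝓘(ℝ, E) ∞ M] in
lemma contDiffOn_formInCoord (hΩ : DiffForm.SmoothOn Ω Set.univ) (i : M) :
    ContDiffOn ℝ ∞ (fun q : E × ℂ => formInCoord (potential Ω i q.1) q.2)
      (chartBall E i ×ˢ {w : ℂ | w ≠ 0}) := by
  refine ContDiffOn.add ?_ ?_
  · exact ((contDiffOn_potential hΩ i).comp contDiffOn_fst fun q hq => hq.1).clm_comp
      contDiffOn_const
  · exact (contDiffOn_angular.comp contDiffOn_snd fun q hq => hq.2).clm_comp contDiffOn_const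

variable (hΩ : DiffForm.SmoothOn Ω Set.univ)
  (hb : ∀ σ : SmoothSimplex 𝓘(ℝ, E) M 2, ∃ k : ℤ, σ.integral Ω = k + coboundary b σ)

lemma mem_chartBall_of_mem_target {u₀ : (prequantumData hΩ hb).bundle.Total} {q : E × ℂ}
    (hq : q ∈ (extChartAt (totalModel E) u₀).target) : q.1 ∈ chartBall E u₀.proj := by
  rw [PhaseData.extChartAt_target] at hq
  have h1 := hq.1.2.2
  rwa [Set.mem_preimage, (extChartAt 𝓘(ℝ, E) u₀.proj).right_inv hq.1.1] at h1

lemma inChart_prequantumForm {u₀ : (prequantumData hΩ hb).bundle.Total} {q : E × ℂ}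
    (hq : q ∈ (extChartAt (totalModel E) u₀).target) (hw : q.2 ≠ 0) :
    DiffForm.inChart (prequantumData hΩ hb).form u₀ q =
      oneFormLIE (E × ℂ) (formInCoord (potential Ω u₀.proj q.1) q.2) := by
  have hp : q.1 ∈ chartBall E u₀.proj := mem_chartBall_of_mem_target hΩ hb hq
  obtain ⟨x, hx⟩ : ∃ x, (extChartAt 𝓘(ℝ, E) u₀.proj).symm q.1 = x := ⟨_, rfl⟩
  refine PhaseData.inChart_form hq hw hx ?_
  have hG := hasFDerivAt_transition hΩ hb (i := u₀.proj) (j := x)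
    (h := (extChartAt 𝓘(ℝ, E) u₀.proj).symm)
    (isOpen_chart_overlap u₀.proj (isOpen_ballNhd E x))
    ((contMDiffOn_symm_chartBall u₀.proj).mono Set.inter_subset_left)
    (fun p hp => symm_mem_ballNhd hp.1) (fun p hp => hp.2) (x := q.1)
    ⟨hp, by rw [Set.mem_preimage, hx]; exact mem_ballNhd_self E x⟩
  have hzero : pulledPotential Ω x (extChartAt 𝓘(ℝ, E) u₀.proj).symm q.1 = 0 := by
    rw [← hx, pulledPotential_center]
  rw [pulledPotential_symm hp, hzero, sub_zero, hx] at hG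
  exact hG

lemma smoothOn_prequantumForm : DiffForm.SmoothOn (prequantumData hΩ hb).form
    (prequantumData hΩ hb).bundle.nonzero := by
  intro u₀
  refine (((oneFormLIE (E × ℂ)).contDiff (n := ∞)).comp_contDiffOn
    ((contDiffOn_formInCoord hΩ u₀.proj).mono ?_)).congr ?_
  · intro q hq
    exact ⟨mem_chartBall_of_mem_target hΩ hb hq.1,
      PhaseData.snd_ne_zero_of_symm_mem_nonzero hq.2⟩
  · intro q hq
    exact inChart_prequantumForm hΩ hb hq.1 (PhaseData.snd_ne_zero_of_symm_mem_nonzero hq.2)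

/-- The connection on the prequantum bundle. -/
def prequantumConnection : ConnectionForm (prequantumData hΩ hb).bundle where
  form := (prequantumData hΩ hb).form
  smooth := smoothOn_prequantumForm hΩ hb
  invariant _ hz u _ := PhaseData.form_invariant hz u
  generator u hu := by
    rw [PhaseData.form_vertical _ hu]
    have := Real.pi_pos
    simp
    field_simp
  radial u hu := by
    rw [PhaseData.form_vertical _ hu]
    simp

lemma prequantumConnection_hasCurvature : (prequantumConnection hΩ hb).HasCurvature Ω := by
  intro u hu
  ext v
  refine (PhaseData.d_form hu (A := potential Ω u.proj)
    (hasFDerivAt_radialPrimitive (chartRadius_pos E u.proj) (contDiffOn_inChart hΩ u.proj))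
    (fun q hq hw => inChart_prequantumForm hΩ hb hq hw) v).trans ?_
  have hp : DiffForm.pullback (TotalSpace.proj : (prequantumData hΩ hb).bundle.Total → M) Ω u v =
      Ω u.proj ![(show E × ℂ from v 0).1, (show E × ℂ from v 1).1] := by
    refine congrArg (Ω u.proj) ?_
    funext k
    refine (mfderiv_proj _ u (v k)).trans ?_
    fin_cases k <;> rfl
  have key : ∀ (A : E [⋀^Fin 2]→L[ℝ] ℝ) (X Y : E),
      ((1 / 2 : ℝ) • curryTwo A) X Y - ((1 / 2 : ℝ) • curryTwo A) Y X = A ![X, Y] := by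
    intro A X Y
    simp only [smul_apply, curryTwo_apply, smul_eq_mul]
    rw [alternating_two_swap A Y X]
    ring
  exact (key _ _ _).trans ((inChart_self Ω u.proj _).trans hp.symm)

end PrequantumForm

section Holonomy

variable {E : Type*} [NormedAddCommGroup E] [NormedSpace ℝ E] [FiniteDimensional ℝ E]
  {M : Type*} [TopologicalSpace M] [ChartedSpace E M] [IsManifold 𝓘(ℝ, E) ∞ M]
  {Ω : DiffForm 𝓘(ℝ, E) M 2} {b : SmoothSimplex 𝓘(ℝ, E) M 1 → ℝ}
  (hΩ : DiffForm.SmoothOn Ω Set.univ)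
  (hb : ∀ σ : SmoothSimplex 𝓘(ℝ, E) M 2, ∃ k : ℤ, σ.integral Ω = k + coboundary b σ)

/-- The section of the prequantum bundle (over points) that is horizontal along the curves on whose
segments the cochain vanishes. -/
def phaseSection (x : M) : (prequantumData hΩ hb).bundle.Total :=
  ⟨x, (phase (radialValue b x x) : ℂ)⟩

lemma coord_phaseSection (i x : M) :
    (prequantumData hΩ hb).coord i (phaseSection hΩ hb x) = phase (radialValue b i x) := by
  change phase (radialValue b i x - radialValue b x x) * phase (radialValue b x x) = _
  rw [← phase_add, sub_add_cancel]

variable {γ : ℝ → M} (hγ : ContMDiff 𝓘(ℝ, ℝ) 𝓘(ℝ, E) ∞ γ)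
  (hseg : ∀ s t : ℝ, onCurve b (segmentCurve γ s t) = 0)

include hγ hseg hΩ hb

lemma phase_radialValue_curve (i : M) (x y : ℝ)
    (hxy : ∀ t ∈ Set.Icc (0 : ℝ) 1, x + t • (y - x) ∈ γ ⁻¹' ballNhd E i) :
    phase (radialValue b i (γ y)) = phase (radialValue b i (γ x)) *
      phase (∫ t in (0 : ℝ)..1, (-pulledPotential Ω i γ (x + t • (y - x))) (y - x)) := by
  rw [phase_radialValue_segment hΩ hb ((isOpen_ballNhd E i).preimage hγ.continuous)
    hγ.contMDiffOn (fun _ h => h) hxy, hseg, phase_zero, mul_one]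
  simp only [neg_apply, intervalIntegral.integral_neg]

lemma contMDiff_phaseSection_curve :
    ContMDiff 𝓘(ℝ, ℝ) (totalModel E) ∞ (fun t => phaseSection hΩ hb (γ t)) := by
  intro t
  refine contMDiffAt_totalSpace.2 ⟨hγ t, ?_⟩
  have ho : IsOpen (γ ⁻¹' ballNhd E (γ t)) := (isOpen_ballNhd E (γ t)).preimage hγ.continuous
  have h := contDiffOn_of_phase_integral (G := fun s => phase (radialValue b (γ t) (γ s)))
    (κ := fun s => -pulledPotential Ω (γ t) γ s) ho
    (contDiffOn_pulledPotential hΩ ho hγ.contMDiffOn fun _ h => h).neg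
    (phase_radialValue_curve hΩ hb hγ hseg (γ t))
  refine (h.contDiffAt (ho.mem_nhds (mem_ballNhd_self E (γ t)))).contMDiffAt.congr_of_eventuallyEq
    (Filter.Eventually.of_forall fun s => ?_)
  exact coord_phaseSection hΩ hb (γ t) (γ s)

lemma form_phaseSection_curve (t : ℝ) :
    (prequantumData hΩ hb).form (phaseSection hΩ hb (γ t))
      ![mfderiv 𝓘(ℝ, ℝ) (totalModel E) (fun t => phaseSection hΩ hb (γ t)) t (1 : ℝ)] = 0 := by
  have hm := (contMDiff_phaseSection_curve hΩ hb hγ hseg t).mdifferentiableAt (by simp)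
  refine (PhaseData.form_mfderiv hm (1 : ℝ)).trans ?_
  have ho : IsOpen (γ ⁻¹' ballNhd E (γ t)) := (isOpen_ballNhd E (γ t)).preimage hγ.continuous
  have h := hasFDerivAt_of_phase_integral (G := fun s => phase (radialValue b (γ t) (γ s)))
    (κ := fun s => -pulledPotential Ω (γ t) γ s) ho
    (contDiffOn_pulledPotential hΩ ho hγ.contMDiffOn fun _ h => h).neg
    (phase_radialValue_curve hΩ hb hγ hseg (γ t)) (mem_ballNhd_self E (γ t))
  have hz : mfderiv 𝓘(ℝ, ℝ) 𝓘(ℝ, ℂ) (fun s => (prequantumData hΩ hb).coord (γ t)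
      (phaseSection hΩ hb (γ s))) t (1 : ℝ) = (0 : ℂ) := by
    refine (congrArg (fun g : ℝ → ℂ => (mfderiv 𝓘(ℝ, ℝ) 𝓘(ℝ, ℂ) g t : ℝ →L[ℝ] ℂ) 1)
      (funext fun s => coord_phaseSection hΩ hb (γ t) (γ s))).trans ?_
    rw [mfderiv_eq_fderiv]
    refine (congrArg (fun L : ℝ →L[ℝ] ℂ => L 1) h.fderiv).trans ?_
    rw [pulledPotential_center]
    simp
  exact (congrArg (angular _) hz).trans (map_zero _)

lemma prequantumConnection_hasHolonomy_zero (hp : Function.Periodic γ 1) :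
    (prequantumConnection hΩ hb).HasHolonomy γ 0 := by
  refine ⟨fun t => phaseSection hΩ hb (γ t), contMDiff_phaseSection_curve hΩ hb hγ hseg,
    fun t => by simp only [hp t], fun t => phase_ne_zero _, fun t => rfl, ?_⟩
  have h : ∀ t : ℝ, (prequantumConnection hΩ hb).form (phaseSection hΩ hb (γ t))
      ![mfderiv 𝓘(ℝ, ℝ) (totalModel E) (fun t => phaseSection hΩ hb (γ t)) t (1 : ℝ)] = 0 :=
    form_phaseSection_curve hΩ hb hγ hseg
  simp [h]

end Holonomy

section FixedPoints

variable {E : Type*} [NormedAddCommGroup E] [NormedSpace ℝ E]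

/-- The fixed space of an anti-symplectic linear involution is Lagrangian. -/
lemma fixed_iff_orthogonal_fixed (A : E [⋀^Fin 2]→L[ℝ] ℝ)
    (hA : ∀ v, (∀ w, A ![v, w] = 0) → v = 0) (S : E →L[ℝ] E) (hS : ∀ v, S (S v) = v)
    (hSA : ∀ v w, A ![S v, S w] = -A ![v, w]) (v : E) :
    S v = v ↔ ∀ w, S w = w → A ![v, w] = 0 := by
  simp only [← curryTwo_apply] at hA hSA ⊢
  constructor
  · intro hv w hw
    have h := hSA v w
    rw [hv, hw] at h
    linarith
  · intro h
    refine (sub_eq_zero.1 (hA (v - S v) fun u => ?_)).symm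
    have h1 := h (u + S u) (by rw [map_add, hS, add_comm])
    have h2 := hSA v (u + S u)
    have h3 := hSA v u
    have h4 := hSA v (S u)
    simp only [hS, map_add, map_sub, sub_apply] at *
    linarith

/-- The inverse function theorem, with smoothness on all of the source and the target. -/
lemma exists_openPartialHomeomorph_of_contDiffOn [CompleteSpace E] {g : E → E} {O : Set E}
    (hO : IsOpen O) (hg : ContDiffOn ℝ ∞ g O) {c : E} (hc : c ∈ O)
    (hgc : HasFDerivAt g (ContinuousLinearMap.id ℝ E) c) :
    ∃ P : OpenPartialHomeomorph E E, (∀ p, P p = g p) ∧ c ∈ P.source ∧ P.source ⊆ O ∧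
      ContDiffOn ℝ ∞ P.symm P.target := by
  have hgc' : HasFDerivAt g ((ContinuousLinearEquiv.refl ℝ E : E ≃L[ℝ] E) : E →L[ℝ] E) c := hgc
  have hat : ContDiffAt ℝ ∞ g c := hg.contDiffAt (hO.mem_nhds hc)
  have hne : (∞ : ℕ∞ω) ≠ 0 := by simp
  let Q := hat.toOpenPartialHomeomorph g hgc' hne
  let O' : Set E := O ∩ fderiv ℝ g ⁻¹' Set.range ((↑) : (E ≃L[ℝ] E) → E →L[ℝ] E)
  have hO' : IsOpen O' := (hg.continuousOn_fderiv_of_isOpen hO (by simp)).isOpen_inter_preimage hO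
    ContinuousLinearEquiv.isOpen
  have hcO' : c ∈ O' := ⟨hc, ContinuousLinearEquiv.refl ℝ E, hgc'.fderiv.symm⟩
  refine ⟨Q.restrOpen O' hO', fun p => rfl, ⟨?_, hcO'⟩, fun p hp => hp.2.1, fun q hq => ?_⟩
  · exact hat.mem_toOpenPartialHomeomorph_source hgc' hne
  · have hp : (Q.restrOpen O' hO').symm q ∈ (Q.restrOpen O' hO').source :=
      (Q.restrOpen O' hO').map_target hq
    obtain ⟨e, he⟩ := hp.2.2
    have hsm : ContDiffAt ℝ ∞ g ((Q.restrOpen O' hO').symm q) :=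
      hg.contDiffAt (hO.mem_nhds hp.2.1)
    refine ((Q.restrOpen O' hO').contDiffAt_symm (f₀' := e) hq ?_ hsm).contDiffWithinAt
    rw [he]
    exact (hsm.differentiableAt (by simp)).hasFDerivAt

variable {M : Type*} [TopologicalSpace M] [ChartedSpace E M] [IsManifold 𝓘(ℝ, E) ∞ M]

/-- Near a fixed point, an involution is linear in a suitable chart. -/
lemma exists_chart_linearizing [CompleteSpace E] {R : M → M}
    (hR : ContMDiff 𝓘(ℝ, E) 𝓘(ℝ, E) ∞ R) (hRR : Function.Involutive R) {x : M} (hx : R x = x) :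
    ∃ φ ∈ IsManifold.maximalAtlas 𝓘(ℝ, E) ∞ M, x ∈ φ.source ∧ ∃ A : E →L[ℝ] E,
      (∀ y ∈ φ.source, R y ∈ φ.source) ∧ ∀ y ∈ φ.source, φ (R y) = A (φ y) := by
  let ψ := chartAt E x
  have hxψ : x ∈ ψ.source := mem_chart_source E x
  have hψ : ContMDiffOn 𝓘(ℝ, E) 𝓘(ℝ, E) ∞ ψ ψ.source := contMDiffOn_chart
  have hψ' : ContMDiffOn 𝓘(ℝ, E) 𝓘(ℝ, E) ∞ ψ.symm ψ.target := contMDiffOn_chart_symm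
  let O : Set E := ψ.target ∩ ψ.symm ⁻¹' (R ⁻¹' ψ.source)
  have hO : IsOpen O := ψ.symm.isOpen_inter_preimage (ψ.open_source.preimage hR.continuous)
  have hc : ψ x ∈ O := ⟨ψ.map_source hxψ, by
    change R (ψ.symm (ψ x)) ∈ ψ.source
    rw [ψ.left_inv hxψ, hx]
    exact hxψ⟩
  let ρ : E → E := fun p => ψ (R (ψ.symm p))
  have hρ : ContDiffOn ℝ ∞ ρ O :=
    (hψ.comp (hR.comp_contMDiffOn (hψ'.mono Set.inter_subset_left)) fun p hp => hp.2).contDiffOn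
  have hρc : ρ (ψ x) = ψ x := by
    change ψ (R (ψ.symm (ψ x))) = ψ x
    rw [ψ.left_inv hxψ, hx]
  have hρρ : ∀ p ∈ O, ρ (ρ p) = p := by
    intro p hp
    change ψ (R (ψ.symm (ψ (R (ψ.symm p))))) = p
    rw [ψ.left_inv hp.2, hRR, ψ.right_inv hp.1]
  let A : E →L[ℝ] E := fderiv ℝ ρ (ψ x)
  have hA : HasFDerivAt ρ A (ψ x) :=
    ((hρ.contDiffAt (hO.mem_nhds hc)).differentiableAt (by simp)).hasFDerivAt
  have hAA : A.comp A = ContinuousLinearMap.id ℝ E := by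
    have hA' : HasFDerivAt ρ A (ρ (ψ x)) := by rwa [hρc]
    have h1 : HasFDerivAt (ρ ∘ ρ) (A.comp A) (ψ x) := hA'.comp (ψ x) hA
    refine h1.unique ((hasFDerivAt_id (ψ x)).congr_of_eventuallyEq ?_)
    filter_upwards [hO.mem_nhds hc] with p hp using hρρ p hp
  have hAA' : ∀ v, A (A v) = v := fun v => congrArg (fun L : E →L[ℝ] E => L v) hAA
  let g : E → E := fun p => (1 / 2 : ℝ) • (p + A (ρ p))
  have hg : ContDiffOn ℝ ∞ g O :=
    contDiffOn_const.smul (contDiffOn_id.add (A.contDiff.comp_contDiffOn hρ))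
  have hgc : HasFDerivAt g (ContinuousLinearMap.id ℝ E) (ψ x) := by
    have h1 := ((hasFDerivAt_id (𝕜 := ℝ) (ψ x)).add
      (A.hasFDerivAt.comp (ψ x) hA)).const_smul (1 / 2 : ℝ)
    refine h1.congr_fderiv ?_
    rw [hAA, ← two_smul ℝ, smul_smul]
    norm_num
  obtain ⟨P, hPg, hPc, hPO, hPs⟩ := exists_openPartialHomeomorph_of_contDiffOn hO hg hc hgc
  let e := ψ.trans P
  have hsource : e.source = ψ.source ∩ ψ ⁻¹' P.source := ψ.trans_source P
  have hxe : x ∈ e.source := by rw [hsource]; exact ⟨hxψ, hPc⟩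
  let φ := e.restrOpen (R ⁻¹' e.source) (e.open_source.preimage hR.continuous)
  have hφ : ∀ y, φ y = g (ψ y) := fun y => hPg _
  have hφs : ∀ y ∈ φ.source, y ∈ ψ.source ∧ ψ y ∈ P.source := fun y hy => by
    have h := hy.1
    rw [hsource] at h
    exact h
  have hmaps : ∀ y ∈ φ.source, R y ∈ φ.source := fun y hy =>
    ⟨hy.2, by change R (R y) ∈ e.source; rw [hRR]; exact hy.1⟩
  refine ⟨φ, φ.mem_maximalAtlas_of_contMDiffOn ?_ ?_, ⟨hxe, by
    change R x ∈ e.source; rw [hx]; exact hxe⟩, A, hmaps, fun y hy => ?_⟩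
  · refine ((hg.contMDiffOn.comp (hψ.mono fun y hy => (hφs y hy).1)
      fun y hy => hPO (hφs y hy).2)).congr fun y hy => hφ y
  · have h1 : φ.target ⊆ e.target := fun q hq => by
      have := e.map_source (φ.map_target hq).1
      rwa [show e (φ.symm q) = q from φ.right_inv hq] at this
    have h2 : ∀ q ∈ e.target, q ∈ P.target ∧ P.symm q ∈ ψ.target := fun q hq => by
      rwa [show e.target = _ from ψ.trans_target P] at hq
    exact hψ'.comp (hPs.contMDiffOn.mono fun q hq => (h2 q (h1 hq)).1) fun q hq => (h2 q (h1 hq)).2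
  · have h1 := (hφs y hy).1
    have h2 := (hφs _ (hmaps y hy)).1
    rw [hφ, hφ]
    change (1 / 2 : ℝ) • (ψ (R y) + A (ψ (R (ψ.symm (ψ (R y)))))) =
      A ((1 / 2 : ℝ) • (ψ y + A (ψ (R (ψ.symm (ψ y))))))
    rw [ψ.left_inv h1, ψ.left_inv h2, hRR, map_smul, map_add, hAA', add_comm]

/-- The fixed point set of an anti-symplectic involution is a Lagrangian submanifold. -/
lemma isLagrangianSubmanifold_fixedPoints [CompleteSpace E] {Ω : DiffForm 𝓘(ℝ, E) M 2}
    (hΩ : ∀ (x : M) (v : TangentSpace 𝓘(ℝ, E) x), (∀ w, Ω x ![v, w] = 0) → v = 0) {R : M → M}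
    (hR : IsAntisymplecticInvolution Ω R) :
    IsLagrangianSubmanifold Ω (Function.fixedPoints R) := by
  intro x hx
  obtain ⟨φ, hφ, hxφ, A, hmaps, hA⟩ := exists_chart_linearizing hR.smooth hR.involutive hx
  have hmd : φ.MDifferentiable 𝓘(ℝ, E) 𝓘(ℝ, E) :=
    ⟨(contMDiffOn_of_mem_maximalAtlas hφ).mdifferentiableOn (by simp),
      (contMDiffOn_symm_of_mem_maximalAtlas hφ).mdifferentiableOn (by simp)⟩
  refine ⟨φ, hφ, hxφ, LinearMap.eqLocus A (LinearMap.id : E →ₗ[ℝ] E), fun y hy => ?_,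
    fun y hy hyR v => ?_⟩
  · change R y = y ↔ A (φ y) = φ y
    rw [← hA y hy]
    exact ⟨fun h => by rw [h], fun h => φ.injOn (hmaps y hy) hy h⟩
  · have hy' : R y = y := hyR
    let S : E →L[ℝ] E := mfderiv 𝓘(ℝ, E) 𝓘(ℝ, E) R y
    let L : E →L[ℝ] E := mfderiv 𝓘(ℝ, E) 𝓘(ℝ, E) φ y
    have hLinj : Function.Injective L := hmd.mfderiv_injective hy
    have hRd : ∀ z, MDifferentiableAt 𝓘(ℝ, E) 𝓘(ℝ, E) R z := fun z =>
      (hR.smooth z).mdifferentiableAt (by simp)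
    have hS : ∀ v, S (S v) = v := by
      intro v
      have h1 := mfderiv_comp y (hRd (R y)) (hRd y)
      have h2 : R ∘ R = id := funext hR.involutive
      rw [h2, mfderiv_id] at h1
      have h3 : (mfderiv 𝓘(ℝ, E) 𝓘(ℝ, E) R (R y) : E →L[ℝ] E) = S :=
        congrArg (fun z => show E →L[ℝ] E from mfderiv 𝓘(ℝ, E) 𝓘(ℝ, E) R z) hy'
      have h4 : (mfderiv 𝓘(ℝ, E) 𝓘(ℝ, E) R (R y) : E →L[ℝ] E) (S v) = v :=
        (congrArg (fun L : E →L[ℝ] E => L v) h1).symm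
      rwa [h3] at h4
    have hSA : ∀ v w : E, (Ω y : E [⋀^Fin 2]→L[ℝ] ℝ) ![S v, S w] =
        -(Ω y : E [⋀^Fin 2]→L[ℝ] ℝ) ![v, w] := by
      intro v w
      have h1 := congrArg (fun B : E [⋀^Fin 2]→L[ℝ] ℝ => B ![v, w]) (congrFun hR.anti y)
      have h2 : (Ω (R y) : E [⋀^Fin 2]→L[ℝ] ℝ) ![S v, S w] =
          (Ω y : E [⋀^Fin 2]→L[ℝ] ℝ) ![S v, S w] :=
        congrArg (fun z => (Ω z : E [⋀^Fin 2]→L[ℝ] ℝ) ![S v, S w]) hy'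
      rw [← h2]
      refine Eq.trans (congrArg (Ω (R y) : E [⋀^Fin 2]→L[ℝ] ℝ) ?_) h1
      funext k
      fin_cases k <;> rfl
    have hLS : ∀ v, L (S v) = A (L v) := by
      intro v
      have hφd : ∀ z ∈ φ.source, MDifferentiableAt 𝓘(ℝ, E) 𝓘(ℝ, E) φ z := fun z hz =>
        hmd.mdifferentiableAt hz
      have h1 := mfderiv_comp y (hφd (R y) (hmaps y hy)) (hRd y)
      have hAd : MDifferentiableAt 𝓘(ℝ, E) 𝓘(ℝ, E) A (φ y) :=
        A.differentiableAt.mdifferentiableAt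
      have h2 := mfderiv_comp y hAd (hφd y hy)
      have h3 : φ ∘ R =ᶠ[𝓝 y] A ∘ φ := by
        filter_upwards [φ.open_source.mem_nhds hy] with z hz using hA z hz
      have h4 := h3.mfderiv_eq (I := 𝓘(ℝ, E)) (I' := 𝓘(ℝ, E))
      rw [h1, h2, mfderiv_eq_fderiv, A.fderiv] at h4
      have h5 : (mfderiv 𝓘(ℝ, E) 𝓘(ℝ, E) φ (R y) : E →L[ℝ] E) = L :=
        congrArg (fun z => show E →L[ℝ] E from mfderiv 𝓘(ℝ, E) 𝓘(ℝ, E) φ z) hy'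
      have h6 : (mfderiv 𝓘(ℝ, E) 𝓘(ℝ, E) φ (R y) : E →L[ℝ] E) (S v) = A (L v) :=
        congrArg (fun L : E →L[ℝ] E => L v) h4
      rwa [h5] at h6
    have hfix : ∀ v, A (L v) = L v ↔ S v = v := fun v => by
      rw [← hLS]
      exact hLinj.eq_iff
    have key := fixed_iff_orthogonal_fixed (E := E) (Ω y) (hΩ y) S hS hSA v
    refine (hfix v).trans (key.trans (forall_congr' fun w => ?_))
    exact imp_congr_left (hfix w).symm

end FixedPoints

section Involution

variable {E : Type*} [NormedAddCommGroup E] [NormedSpace ℝ E]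
  {M : Type*} [TopologicalSpace M] [ChartedSpace E M]

/-- The image of a smooth simplex under a smooth map. -/
def SmoothSimplex.map {n : ℕ} (R : M → M) (hR : ContMDiff 𝓘(ℝ, E) 𝓘(ℝ, E) ∞ R)
    (σ : SmoothSimplex 𝓘(ℝ, E) M n) : SmoothSimplex 𝓘(ℝ, E) M n where
  toFun t := R (σ.toFun t)
  smooth := by
    obtain ⟨U, f, hU, hsub, hf, heq⟩ := σ.smooth
    exact ⟨U, R ∘ f, hU, hsub, hR.comp_contMDiffOn hf, fun t => congrArg R (heq t)⟩

variable {R : M → M} (hR : ContMDiff 𝓘(ℝ, E) 𝓘(ℝ, E) ∞ R)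

lemma SmoothSimplex.face_map {n : ℕ} (σ : SmoothSimplex 𝓘(ℝ, E) M (n + 1)) (i : Fin (n + 2)) :
    (σ.map R hR).face i = (σ.face i).map R hR :=
  SmoothSimplex.ext' fun _ => rfl

lemma SmoothSimplex.param_map {n : ℕ} (σ : SmoothSimplex 𝓘(ℝ, E) M n) :
    (σ.map R hR).param = R ∘ σ.param := by
  funext t
  simp only [SmoothSimplex.param, Function.comp_apply]
  split_ifs <;> rfl

lemma isOpen_openSimplex (n : ℕ) : IsOpen {t : Fin n → ℝ | (∀ i, 0 < t i) ∧ ∑ i, t i < 1} := by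
  have h : {t : Fin n → ℝ | (∀ i, 0 < t i) ∧ ∑ i, t i < 1} =
      (⋂ i, {t : Fin n → ℝ | 0 < t i}) ∩ {t : Fin n → ℝ | ∑ i, t i < 1} := by
    ext t; simp
  rw [h]
  exact (isOpen_iInter_of_finite fun i => isOpen_lt continuous_const (continuous_apply i)).inter
    (isOpen_lt (by fun_prop) continuous_const)

lemma cons_mem_stdSimplex {n : ℕ} {t : Fin n → ℝ} (ht : ∀ i, 0 ≤ t i) (hs : ∑ i, t i ≤ 1) :
    (Fin.cons (1 - ∑ i, t i) t : Fin (n + 1) → ℝ) ∈ stdSimplex ℝ (Fin (n + 1)) := by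
  refine ⟨fun j => ?_, ?_⟩
  · refine Fin.cases ?_ (fun k => ?_) j
    · rw [Fin.cons_zero]
      linarith
    · rw [Fin.cons_succ]
      exact ht k
  · rw [Fin.sum_univ_succ]
    simp

lemma SmoothSimplex.mdifferentiableAt_param {n : ℕ} (σ : SmoothSimplex 𝓘(ℝ, E) M n)
    {t : Fin n → ℝ} (ht : (∀ i, 0 < t i) ∧ ∑ i, t i < 1) :
    MDifferentiableAt 𝓘(ℝ, Fin n → ℝ) 𝓘(ℝ, E) σ.param t := by
  obtain ⟨U, f, hU, hsub, hf, heq⟩ := σ.smooth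
  have hmem : ∀ s : Fin n → ℝ, ((∀ i, 0 < s i) ∧ ∑ i, s i < 1) →
      (Fin.cons (1 - ∑ i, s i) s : Fin (n + 1) → ℝ) ∈ stdSimplex ℝ (Fin (n + 1)) := fun s hs =>
    cons_mem_stdSimplex (fun i => (hs.1 i).le) hs.2.le
  have hcons : Differentiable ℝ
      (fun s : Fin n → ℝ => (Fin.cons (1 - ∑ i, s i) s : Fin (n + 1) → ℝ)) := by
    rw [differentiable_pi]
    intro j
    refine Fin.cases ?_ (fun k => ?_) j
    · simp only [Fin.cons_zero]
      fun_prop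
    · simp only [Fin.cons_succ]
      fun_prop
  have hfd : MDifferentiableAt 𝓘(ℝ, Fin (n + 1) → ℝ) 𝓘(ℝ, E) f
      (Fin.cons (1 - ∑ i, t i) t : Fin (n + 1) → ℝ) :=
    (hf.contMDiffAt (hU.mem_nhds (hsub (hmem t ht)))).mdifferentiableAt (by simp)
  refine (MDifferentiableAt.comp
    (f := fun s : Fin n → ℝ => (Fin.cons (1 - ∑ i, s i) s : Fin (n + 1) → ℝ)) t hfd
    (hcons t).mdifferentiableAt).congr_of_eventuallyEq ?_
  filter_upwards [(isOpen_openSimplex n).mem_nhds ht] with s hs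
  rw [SmoothSimplex.param, dif_pos (hmem s hs), heq]
  rfl

lemma SmoothSimplex.integral_map {n : ℕ} {Ω : DiffForm 𝓘(ℝ, E) M n}
    (hΩ : DiffForm.pullback R Ω = -Ω) (σ : SmoothSimplex 𝓘(ℝ, E) M n) :
    (σ.map R hR).integral Ω = -σ.integral Ω := by
  rw [SmoothSimplex.integral, SmoothSimplex.integral, ← MeasureTheory.integral_neg]
  refine MeasureTheory.setIntegral_congr_fun (isOpen_openSimplex n).measurableSet fun t ht => ?_
  rw [SmoothSimplex.param_map, pullback_comp Ω ((hR _).mdifferentiableAt (by simp))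
    (σ.mdifferentiableAt_param ht), hΩ]
  rfl

lemma SmoothSimplex.integral_smul {n : ℕ} (Ω : DiffForm 𝓘(ℝ, E) M n) (r : ℝ)
    (σ : SmoothSimplex 𝓘(ℝ, E) M n) : σ.integral (r • Ω) = r * σ.integral Ω := by
  rw [SmoothSimplex.integral, SmoothSimplex.integral, ← MeasureTheory.integral_const_mul]
  rfl

lemma DiffForm.SmoothOn.const_smul {n : ℕ} {Ω : DiffForm 𝓘(ℝ, E) M n} {U : Set M}
    (hΩ : DiffForm.SmoothOn Ω U) (r : ℝ) : DiffForm.SmoothOn (r • Ω) U := fun x₀ =>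
  ContDiffOn.const_smul r (hΩ x₀)

/-- The antisymmetrization `b - R^* b` of a 1-cochain. -/
def antisymmetrize (b : SmoothSimplex 𝓘(ℝ, E) M 1 → ℝ) (σ : SmoothSimplex 𝓘(ℝ, E) M 1) : ℝ :=
  b σ - b (σ.map R hR)

lemma coboundary_antisymmetrize (b : SmoothSimplex 𝓘(ℝ, E) M 1 → ℝ)
    (σ : SmoothSimplex 𝓘(ℝ, E) M 2) :
    coboundary (antisymmetrize hR b) σ = coboundary b σ - coboundary b (σ.map R hR) := by
  simp only [coboundary, antisymmetrize, SmoothSimplex.face_map, smul_sub, Finset.sum_sub_distrib]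

lemma integral_two_smul_eq {Ω : DiffForm 𝓘(ℝ, E) M 2} (hΩ : DiffForm.pullback R Ω = -Ω)
    {c : SmoothSimplex 𝓘(ℝ, E) M 2 → ℤ} {b : SmoothSimplex 𝓘(ℝ, E) M 1 → ℝ}
    (hb : ∀ σ : SmoothSimplex 𝓘(ℝ, E) M 2, σ.integral Ω = c σ + coboundary b σ)
    (σ : SmoothSimplex 𝓘(ℝ, E) M 2) :
    ∃ k : ℤ, σ.integral (((2 : ℕ) : ℝ) • Ω) = k + coboundary (antisymmetrize hR b) σ := by
  refine ⟨c σ - c (σ.map R hR), ?_⟩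
  have h1 := hb σ
  have h2 := hb (σ.map R hR)
  rw [SmoothSimplex.integral_map hR hΩ] at h2
  rw [SmoothSimplex.integral_smul, coboundary_antisymmetrize]
  push_cast
  linarith

lemma onCurve_antisymmetrize (b : SmoothSimplex 𝓘(ℝ, E) M 1 → ℝ) {γ : ℝ → M}
    (hγ : ∀ t, R (γ t) = γ t) : onCurve (antisymmetrize hR b) γ = 0 := by
  by_cases h : ContMDiff 𝓘(ℝ, ℝ) 𝓘(ℝ, E) ∞ γ
  · rw [onCurve_eq _ h, antisymmetrize, sub_eq_zero]
    congr 1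
    exact SmoothSimplex.ext' fun t => (hγ _).symm
  · exact dif_neg h

end Involution

end BohrSommerfeld

end

open BohrSommerfeld in
theorem mainTheorem5
    {E : Type*} [NormedAddCommGroup E] [NormedSpace ℝ E] [FiniteDimensional ℝ E]
    {M : Type*} [TopologicalSpace M] [T2Space M] [SecondCountableTopology M]
    [ChartedSpace E M] [IsManifold 𝓘(ℝ, E) ∞ M]
    (Ω : DiffForm 𝓘(ℝ, E) M 2) (hΩ : IsSymplectic Ω) (hint : IsIntegral Ω)
    (R : M → M) (hR : IsAntisymplecticInvolution Ω R) :
    ∃ (B : ComplexLineBundle E M) (α : ConnectionForm B),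
      IsBohrSommerfeldPair Ω (Function.fixedPoints R) B α := by
  obtain ⟨c, -, b, hb⟩ := hint
  have : CompleteSpace E := FiniteDimensional.complete ℝ E
  have hsm : DiffForm.SmoothOn (((2 : ℕ) : ℝ) • Ω) Set.univ := hΩ.smooth.const_smul _
  have hb' := integral_two_smul_eq hR.smooth hR.anti hb
  refine ⟨(prequantumData hsm hb').bundle, prequantumConnection hsm hb',
    isLagrangianSubmanifold_fixedPoints hΩ.nondegenerate hR,
    ⟨2, two_pos, prequantumConnection_hasCurvature hsm hb'⟩,
    fun x => ⟨1, fun p γ hγ hper hp => ?_, fun g => Or.inl rfl⟩⟩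
  have hfix : ∀ t, R (γ t) = γ t := by
    intro t
    have h1 : γ (Int.fract t) = γ t := by
      rw [Int.fract]
      simpa using hper.sub_int_mul_eq ⌊t⌋ (x := t)
    have h2 := hp ⟨Int.fract t, Int.fract_nonneg t, (Int.fract_lt_one t).le⟩
    rw [← h1, h2]
    exact (p _).2
  exact prequantumConnection_hasHolonomy_zero hsm hb' hγ
    (fun s t => onCurve_antisymmetrize hR.smooth b fun r => hfix _) hper
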